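/- \textbf{Setting.} Let $(M_1,g_1)$, $(M_2,g_2)$ be nonempty smooth (pseudo-)Riemannian manifolds (without boundary) of dimensions $n_1,n_2$, let $n=n_1+n_2$, and let $f_i:M_i\to(0,\infty)$ be smooth. Let $M=M_1\times M_2$ carry the doubly warped product metric $g=(f_2\circ\pi_2)^2\pi_1^*g_1+(f_1\circ\pi_1)^2\pi_2^*g_2$. Functions and tensors on $M_i$ are identified with their pull-backs to $M$. Write $D,R$ for the Levi-Civita connection and the scalar curvature of $g$, and $D^i,R^i$ for those of $g_i$; $\nabla^i f_i$, $\Delta^i f_i$ and $H^{f_i}$ are the gradient, Laplacian and Hessian of $f_i$ on $(M_i,g_i)$. For $\{i,j\}=\{1,2\}$ put $$\mathcal F^i=\frac{n_j}{f_i}H^{f_i},\qquad f_i^{\diamond}=f_i\,\Delta^i f_i+(n_j-1)\,g_i(\nabla^i f_i,\nabla^i f_i).$$ A (pseudo-)Riemannian manifold of dimension $m$ with metric $h$, Ricci tensor $\mathrm{Ric}$, scalar curvature $S$ and Levi-Civita connection $\nabla$ is of class $\mathcal I\oplus\mathcal A$ if $\mathcal L=\mathrm{Ric}-\frac{2S}{m+2}h$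 is Killing, i.e. $(\nabla_X\mathcal L)(Y,Z)+(\nabla_Y\mathcal L)(Z,X)+(\nabla_Z\mathcal L)(X,Y)=0$ for all $X,Y,Z$. \textbf{Theorem.} Suppose that $(M,g)$ is of class $\mathcal I\oplus\mathcal A$. Then, for each $i\in\{1,2\}$ and with $j\ne i$, the factor $(M_i,g_i)$ is of class $\mathcal I\oplus\mathcal A$ if and only if, at every point of $M$ and for all $X_i$ tangent to $M_i$, $$(D^i_{X_i}\mathcal F^i)(X_i,X_i)=\frac{2}{f_i^3}\,X_i(f_i)\,g_i(X_i,X_i)\Big[f_j^{\diamond}+(n-2)(\nabla^j f_j)(f_j)\Big]-\frac{2}{n+2}\Big(f_j^2\,D_{X_i}R-\frac{n+2}{n_i+2}\,D^i_{X_i}R^i\Big)g_i(X_i,X_i).$$ -/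

import Mathlib

open scoped Manifold ContDiff

noncomputable section

/-! # Pseudo-Riemannian geometry in a coordinate space

`E` is the coordinate space of a chart and `G` the field of components of a metric in that chart:
`G y v w` is the value at the point `y` of the metric on the constant coordinate fields `v`, `w`. -/

namespace Coord

variable {E : Type*} [NormedAddCommGroup E] [NormedSpace ℝ E]

/-- Raising an index: `sharp b ω` is the vector `v` with `b v · = ω`, for a nondegenerate `b`. -/
def sharp (b : E →L[ℝ] E →L[ℝ] ℝ) : (E →L[ℝ] ℝ) →L[ℝ] E :=
  ContinuousLinearMap.inverse b

set_option maxSynthPendingDepth 3 in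
/-- Christoffel symbols of the first kind,
`(v, w, z) ↦ (∂_v G(w, z) + ∂_w G(v, z) - ∂_z G(v, w)) / 2`. -/
def christoffelLow (G : E → E →L[ℝ] E →L[ℝ] ℝ) (y : E) : E →L[ℝ] E →L[ℝ] E →L[ℝ] ℝ :=
  let dG : E →L[ℝ] E →L[ℝ] E →L[ℝ] ℝ := fderiv ℝ G y
  let dG' : E →L[ℝ] E →L[ℝ] E →L[ℝ] ℝ :=
    ((ContinuousLinearMap.flipₗᵢ ℝ E E ℝ).toContinuousLinearEquiv :
      (E →L[ℝ] E →L[ℝ] ℝ) →L[ℝ] (E →L[ℝ] E →L[ℝ] ℝ)).comp dG.flip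
  (1 / 2 : ℝ) • (dG + dG.flip - dG')

/-- Christoffel symbols of the Levi-Civita connection: `D_v w = ∂_v w + christoffel G y v w`. -/
def christoffel (G : E → E →L[ℝ] E →L[ℝ] ℝ) (y : E) : E →L[ℝ] E →L[ℝ] E :=
  (ContinuousLinearMap.compL ℝ E (E →L[ℝ] ℝ) E (sharp (G y))).comp (christoffelLow G y)

/-- The curvature endomorphism `u ↦ R(u, v) w`, where `R(u, v) = [D_u, D_v]` on constant fields, i.e.
`R(u, v) w = (∂_u Γ)(v, w) - (∂_v Γ)(u, w) + Γ(u, Γ(v, w)) - Γ(v, Γ(u, w))`. -/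
def riemann (G : E → E →L[ℝ] E →L[ℝ] ℝ) (y v w : E) : E →L[ℝ] E :=
  ((fderiv ℝ (christoffel G) y).flip v).flip w
    - (fderiv ℝ (christoffel G) y v).flip w
    + (christoffel G y).flip (christoffel G y v w)
    - (christoffel G y v).comp ((christoffel G y).flip w)

variable [FiniteDimensional ℝ E]

/-- The Ricci tensor `Ric(v, w) = tr (u ↦ R(u, v) w)`. -/
def ricci (G : E → E →L[ℝ] E →L[ℝ] ℝ) (y : E) : E →L[ℝ] E →L[ℝ] ℝ :=
  (LinearMap.mk₂ ℝ (fun v w ↦ LinearMap.trace ℝ E (riemann G y v w : E →ₗ[ℝ] E))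
    (fun v v' w ↦ by
      rw [← map_add]; congr 1; ext u; simp [riemann]; abel)
    (fun c v w ↦ by
      rw [← map_smul]; congr 1; ext u; simp [riemann, smul_sub, smul_add])
    (fun v w w' ↦ by
      rw [← map_add]; congr 1; ext u; simp [riemann]; abel)
    (fun c v w ↦ by
      rw [← map_smul]; congr 1; ext u
      simp [riemann, smul_sub, smul_add])).toContinuousBilinearMap

/-- The trace of a bilinear form `T` with respect to a nondegenerate form `b`. -/
def metricTrace (b T : E →L[ℝ] E →L[ℝ] ℝ) : ℝ :=
  LinearMap.trace ℝ E ((sharp b).comp T : E →ₗ[ℝ] E)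

/-- The scalar curvature. -/
def scal (G : E → E →L[ℝ] E →L[ℝ] ℝ) (y : E) : ℝ :=
  metricTrace (G y) (ricci G y)

/-- The covariant derivative `(D_u T)(v, w)` of a field `T` of bilinear forms. -/
def covDeriv (G T : E → E →L[ℝ] E →L[ℝ] ℝ) (y u v w : E) : ℝ :=
  fderiv ℝ T y u v w - T y (christoffel G y u v) w - T y v (christoffel G y u w)

/-- The Hessian `H^f(v, w) = ∂_v ∂_w f - df(Γ(v, w))`. -/
def hessian (G : E → E →L[ℝ] E →L[ℝ] ℝ) (f : E → ℝ) (y : E) : E →L[ℝ] E →L[ℝ] ℝ :=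
  fderiv ℝ (fderiv ℝ f) y
    - (ContinuousLinearMap.compL ℝ E E ℝ (fderiv ℝ f y)).comp (christoffel G y)

/-- The Laplacian, the metric trace of the Hessian. -/
def laplacian (G : E → E →L[ℝ] E →L[ℝ] ℝ) (f : E → ℝ) (y : E) : ℝ :=
  metricTrace (G y) (hessian G f y)

/-- The tensor `L = Ric - (2 R / (n + 2)) G`, where `n` is the dimension. -/
def tensorL (G : E → E →L[ℝ] E →L[ℝ] ℝ) (y : E) : E →L[ℝ] E →L[ℝ] ℝ :=
  ricci G y - (2 * scal G y / ((Module.finrank ℝ E : ℝ) + 2)) • G y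

end Coord

/-! # Pseudo-Riemannian manifolds -/

section Manifold

variable {E : Type*} [NormedAddCommGroup E] [NormedSpace ℝ E]
  {H : Type*} [TopologicalSpace H] (I : ModelWithCorners ℝ E H)
  {M : Type*} [TopologicalSpace M] [ChartedSpace H M]

/-- A (pseudo-)Riemannian metric: a smooth field of symmetric nondegenerate bilinear forms on the
tangent spaces. -/
structure IsPseudoRiemannianMetric [IsManifold I ∞ M]
    (g : ∀ x : M, TangentSpace I x →L[ℝ] TangentSpace I x →L[ℝ] ℝ) : Prop where
  symm : ∀ (x : M) (v w : TangentSpace I x), g x v w = g x w v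
  nondegenerate : ∀ (x : M) (v : TangentSpace I x), (∀ w, g x v w = 0) → v = 0
  contMDiff : ContMDiff I (I.prod 𝓘(ℝ, E →L[ℝ] E →L[ℝ] ℝ)) ∞
    (fun x ↦ Bundle.TotalSpace.mk' (E →L[ℝ] E →L[ℝ] ℝ)
      (E := fun x : M ↦ TangentSpace I x →L[ℝ] TangentSpace I x →L[ℝ] ℝ) x (g x))

/-- The components of `g` in the chart around `x`: the pull-back of `g` by the inverse chart. -/
def coordMetric (g : ∀ x : M, TangentSpace I x →L[ℝ] TangentSpace I x →L[ℝ] ℝ) (x : M) :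
    E → E →L[ℝ] E →L[ℝ] ℝ := fun y ↦
  let A : E →L[ℝ] E := mfderiv 𝓘(ℝ, E) I (extChartAt I x).symm y
  let B : E →L[ℝ] E →L[ℝ] ℝ := g ((extChartAt I x).symm y)
  B.bilinearComp A A

/-- The function `f` read in the chart around `x`. -/
def coordFun (f : M → ℝ) (x : M) : E → ℝ := f ∘ (extChartAt I x).symm

/-- The gradient of `f`. -/
def grad (g : ∀ x : M, TangentSpace I x →L[ℝ] TangentSpace I x →L[ℝ] ℝ) (f : M → ℝ) (x : M) :
    TangentSpace I x :=
  Coord.sharp (E := E) (g x) (mfderiv I 𝓘(ℝ, ℝ) f x)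

/-- The derivative `v(f)` of a function `f` in the direction of a tangent vector `v` at `x`. -/
def dirDeriv (f : M → ℝ) (x : M) (v : TangentSpace I x) : ℝ :=
  mfderiv I 𝓘(ℝ, ℝ) f x v

variable [FiniteDimensional ℝ E]

/-! In the chart around `x` the components of the Levi-Civita connection, of `Ric`, `R`, `L` and `H^f`
are functions of the coordinates, obtained from the components of `g` by the classical formulas. The
covariant derivatives at `x` are evaluated in this chart, in which the tangent space at `x` is the
coordinate space `E`. The results are tensorial, so they do not depend on the choice of chart.
The manifolds considered have no boundary. -/

/-- The derivative `D_X R` of the scalar curvature `R` in the direction `X`. -/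
def derivScal (g : ∀ x : M, TangentSpace I x →L[ℝ] TangentSpace I x →L[ℝ] ℝ) (x : M)
    (X : TangentSpace I x) : ℝ :=
  fderiv ℝ (Coord.scal (coordMetric I g x)) (extChartAt I x x) X

/-- The covariant derivative `(D_X L)(Y, Z)` of `L = Ric - (2 R / (n + 2)) g`. -/
def covDerivL (g : ∀ x : M, TangentSpace I x →L[ℝ] TangentSpace I x →L[ℝ] ℝ) (x : M)
    (X Y Z : TangentSpace I x) : ℝ :=
  Coord.covDeriv (coordMetric I g x) (Coord.tensorL (coordMetric I g x)) (extChartAt I x x) X Y Z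

/-- The class `𝓘 ⊕ 𝓐`: the tensor `L = Ric - (2 R / (n + 2)) g` is Killing. -/
def IsClassIA (g : ∀ x : M, TangentSpace I x →L[ℝ] TangentSpace I x →L[ℝ] ℝ) : Prop :=
  ∀ (x : M) (X Y Z : TangentSpace I x),
    covDerivL I g x X Y Z + covDerivL I g x Y Z X + covDerivL I g x Z X Y = 0

/-- The Laplacian of `f`. -/
def laplacianAt (g : ∀ x : M, TangentSpace I x →L[ℝ] TangentSpace I x →L[ℝ] ℝ) (f : M → ℝ)
    (x : M) : ℝ :=
  Coord.laplacian (coordMetric I g x) (coordFun I f x) (extChartAt I x x)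

/-- The covariant derivative `(D_X F)(Y, Z)` of `F = (m / f) H^f`. -/
def covDerivF (m : ℝ) (g : ∀ x : M, TangentSpace I x →L[ℝ] TangentSpace I x →L[ℝ] ℝ) (f : M → ℝ)
    (x : M) (X Y Z : TangentSpace I x) : ℝ :=
  Coord.covDeriv (coordMetric I g x)
    (fun y ↦ (m / coordFun I f x y) • Coord.hessian (coordMetric I g x) (coordFun I f x) y)
    (extChartAt I x x) X Y Z

/-- `f^⋄ = f Δf + (m - 1) g(∇f, ∇f)`. -/
def diamond (m : ℝ) (g : ∀ x : M, TangentSpace I x →L[ℝ] TangentSpace I x →L[ℝ] ℝ) (f : M → ℝ)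
    (x : M) : ℝ :=
  f x * laplacianAt I g f x + (m - 1) * g x (grad I g f x) (grad I g f x)

end Manifold

section DoublyWarped

variable {E₁ E₂ : Type*} [NormedAddCommGroup E₁] [NormedSpace ℝ E₁]
  [NormedAddCommGroup E₂] [NormedSpace ℝ E₂]
  {H₁ H₂ : Type*} [TopologicalSpace H₁] [TopologicalSpace H₂]
  (I₁ : ModelWithCorners ℝ E₁ H₁) (I₂ : ModelWithCorners ℝ E₂ H₂)
  {M₁ M₂ : Type*} [TopologicalSpace M₁] [ChartedSpace H₁ M₁]
  [TopologicalSpace M₂] [ChartedSpace H₂ M₂]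

/-- The doubly warped product metric
`(f₂ ∘ π₂)² π₁^* g₁ + (f₁ ∘ π₁)² π₂^* g₂` on `M₁ × M₂`. -/
def doublyWarped (g₁ : ∀ p : M₁, TangentSpace I₁ p →L[ℝ] TangentSpace I₁ p →L[ℝ] ℝ)
    (g₂ : ∀ q : M₂, TangentSpace I₂ q →L[ℝ] TangentSpace I₂ q →L[ℝ] ℝ)
    (f₁ : M₁ → ℝ) (f₂ : M₂ → ℝ) :
    ∀ x : M₁ × M₂, TangentSpace (I₁.prod I₂) x →L[ℝ] TangentSpace (I₁.prod I₂) x →L[ℝ] ℝ :=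
  fun x ↦
    let A₁ : E₁ × E₂ →L[ℝ] E₁ := mfderiv (I₁.prod I₂) I₁ (Prod.fst : M₁ × M₂ → M₁) x
    let A₂ : E₁ × E₂ →L[ℝ] E₂ := mfderiv (I₁.prod I₂) I₂ (Prod.snd : M₁ × M₂ → M₂) x
    let B₁ : E₁ →L[ℝ] E₁ →L[ℝ] ℝ := g₁ x.1
    let B₂ : E₂ →L[ℝ] E₂ →L[ℝ] ℝ := g₂ x.2
    ((f₂ x.2) ^ 2 • B₁.bilinearComp A₁ A₁ + (f₁ x.1) ^ 2 • B₂.bilinearComp A₂ A₂ :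
      E₁ × E₂ →L[ℝ] E₁ × E₂ →L[ℝ] ℝ)

end DoublyWarped

end

/-! Since `L` is symmetric, polarization turns the Killing identity into `(D_X L)(X, X) = 0` for all
`X`; since the metric is parallel, this says `(D_X Ric)(X, X) = 2/(n+2) X(R) g(X, X)`. So it is
enough to compare `(D_X Ric)(X, X)` on `M` and on `M₁` for `X` tangent to `M₁`.

For `X, Y` tangent to `M₁` and `V` tangent to `M₂`, the Ricci tensor of the product is `Ric(X, Y) =
Ric¹(X, Y) - 𝓕¹(X, Y) - f₂^⋄ / f₁² g₁(X, Y)` and `Ric(X, V) = (n-2) X(f₁) V(f₂) / (f₁ f₂)`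
(`ricci_inl_inl`, `ricci_inl_inr`). Along `M₁` the function `f₂^⋄` is constant and `g₁` is parallel,
so the last term of `Ric(X, X)` contributes only the derivative of `f₁⁻²`. Moreover `D_X X` differs
from `D¹_X X` by `-(f₂ / f₁²) g₁(X, X) ∇²f₂`, which brings in the mixed part of `Ric`. Hence
(`covDeriv_ricci_inl`) `(D_X Ric)(X, X) = (D¹_X Ric¹)(X, X) - (D¹_X 𝓕¹)(X, X) + (2 / f₁³) X(f₁)
g₁(X, X) [f₂^⋄ + (n-2) (∇²f₂)(f₂)]`. When the condition holds on `M`, inserting this formula makes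
the condition on `M₁` equivalent to the stated equation, separately for each point of `M` and each
`X` (`covDeriv_tensorL_eq_zero_iff`).

The computation is made in a product chart. The Ricci tensor is written through traces and
divergences of Christoffel symbols (`ricci_eq`), which split along the two factors. The splitting is
expressed by abstract projections and inclusions, so that `swap` yields the statement for `M₂`. -/

noncomputable section

set_option linter.unusedSectionVars false
set_option maxSynthPendingDepth 3

/-! ### Calculus of fields of bilinear forms on a coordinate space -/

namespace Coord

variable {E : Type*} [NormedAddCommGroup E] [NormedSpace ℝ E]

/-- `G` is a smooth field of symmetric nondegenerate bilinear forms on the open set `U`. -/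
structure IsMetricOn (G : E → E →L[ℝ] E →L[ℝ] ℝ) (U : Set E) : Prop where
  isOpen : IsOpen U
  contDiffOn : ContDiffOn ℝ ∞ G U
  symm : ∀ y ∈ U, ∀ v w, G y v w = G y w v
  nondegenerate : ∀ y ∈ U, ∀ v, (∀ w, G y v w = 0) → v = 0

section Derivatives

variable {F F' F'' : Type*} [NormedAddCommGroup F] [NormedSpace ℝ F]
  [NormedAddCommGroup F'] [NormedSpace ℝ F'] [NormedAddCommGroup F''] [NormedSpace ℝ F'']

theorem fderiv_clm_apply_const {T : E → F →L[ℝ] F'} {y : E} (hT : DifferentiableAt ℝ T y)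
    (u : E) (v : F) : fderiv ℝ (fun z ↦ T z v) y u = fderiv ℝ T y u v := by
  rw [fderiv_clm_apply hT (differentiableAt_const v)]
  simp

theorem fderiv_clm_apply_const₂ {T : E → F →L[ℝ] F' →L[ℝ] F''} {y : E}
    (hT : DifferentiableAt ℝ T y) (u : E) (v : F) (w : F') :
    fderiv ℝ (fun z ↦ T z v w) y u = fderiv ℝ T y u v w := by
  rw [fderiv_clm_apply_const (hT.clm_apply (differentiableAt_const v)),
    fderiv_clm_apply_const hT]

theorem fderiv_clm_apply₂ {T : E → F →L[ℝ] F' →L[ℝ] F''} {a : E → F} {b : E → F'} {y : E}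
    (hT : DifferentiableAt ℝ T y) (ha : DifferentiableAt ℝ a y) (hb : DifferentiableAt ℝ b y)
    (u : E) :
    fderiv ℝ (fun z ↦ T z (a z) (b z)) y u =
      fderiv ℝ T y u (a y) (b y) + T y (fderiv ℝ a y u) (b y) + T y (a y) (fderiv ℝ b y u) := by
  rw [fderiv_clm_apply (hT.clm_apply ha) hb, fderiv_clm_apply hT ha]
  simp
  abel

theorem contDiffOn_clm_apply₂ [FiniteDimensional ℝ F] [FiniteDimensional ℝ F']
    {T : E → F →L[ℝ] F' →L[ℝ] F''} {U : Set E} {k : WithTop ℕ∞} :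
    ContDiffOn ℝ k T U ↔ ∀ v w, ContDiffOn ℝ k (fun z ↦ T z v w) U := by
  rw [contDiffOn_clm_apply]
  exact forall_congr' fun v ↦ contDiffOn_clm_apply

end Derivatives

/-! ### Traces of endomorphisms -/

section Trace

variable [FiniteDimensional ℝ E]

/-- The trace as a continuous linear map. -/
def traceCLM : (E →L[ℝ] E) →L[ℝ] ℝ :=
  LinearMap.toContinuousLinearMap
    (LinearMap.trace ℝ E ∘ₗ ContinuousLinearMap.coeLM ℝ)

theorem traceCLM_apply (A : E →L[ℝ] E) :
    traceCLM A = LinearMap.trace ℝ E (A : E →ₗ[ℝ] E) := rfl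

theorem traceCLM_comp_comm {F : Type*} [NormedAddCommGroup F] [NormedSpace ℝ F]
    [FiniteDimensional ℝ F] (A : E →L[ℝ] F) (B : F →L[ℝ] E) :
    traceCLM (A.comp B) = traceCLM (B.comp A) := by
  exact LinearMap.trace_comp_comm' _ _

theorem traceCLM_id : traceCLM (ContinuousLinearMap.id ℝ E) = Module.finrank ℝ E := by
  simp [traceCLM_apply]

theorem traceCLM_smulRight (θ : E →L[ℝ] ℝ) (v : E) : traceCLM (θ.smulRight v) = θ v := by
  rw [traceCLM_apply]
  exact LinearMap.trace_smulRight ..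

/-- An endomorphism which is skew for a nondegenerate form has trace zero. -/
theorem traceCLM_eq_zero_of_skew (b : E →L[ℝ] E →L[ℝ] ℝ) (hb : ∀ v, (∀ w, b v w = 0) → v = 0)
    (A : E →L[ℝ] E) (hA : ∀ v w, b (A v) w = - b v (A w)) : traceCLM A = 0 := by
  let B : E →ₗ[ℝ] Module.Dual ℝ E :=
    { toFun := fun v ↦ (b v : E →ₗ[ℝ] ℝ)
      map_add' := fun v w ↦ by ext; simp
      map_smul' := fun c v ↦ by ext; simp }
  have hB : Function.Injective B := by
    rw [injective_iff_map_eq_zero]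
    exact fun v hv ↦ hb v fun w ↦ LinearMap.congr_fun hv w
  let e : E ≃ₗ[ℝ] Module.Dual ℝ E :=
    LinearEquiv.ofInjectiveOfFinrankEq B hB Subspace.dual_finrank_eq.symm
  -- Skewness says that `b`, seen as a map to the dual, conjugates `-A` into the transpose of `A`;
  -- hence `-tr A = tr A`.
  have h1 : e.conj (-(A : E →ₗ[ℝ] E)) = Module.Dual.transpose (R := ℝ) (A : E →ₗ[ℝ] E) := by
    ext θ v
    obtain ⟨u, rfl⟩ := e.surjective θ
    simp only [LinearEquiv.conj_apply_apply, LinearEquiv.symm_apply_apply]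
    have : b (-A u) v = b u (A v) := by rw [map_neg, neg_apply, hA, neg_neg]
    exact this
  have h2 := LinearMap.trace_conj' (-(A : E →ₗ[ℝ] E)) e
  rw [h1, map_neg, LinearMap.trace_transpose'] at h2
  rw [traceCLM_apply]
  linarith

end Trace

theorem christoffelLow_apply (G : E → E →L[ℝ] E →L[ℝ] ℝ) (y v w z : E) :
    christoffelLow G y v w z =
      (fderiv ℝ G y v w z + fderiv ℝ G y w v z - fderiv ℝ G y z v w) / 2 := by
  have : ((((ContinuousLinearMap.flipₗᵢ ℝ E E ℝ).toContinuousLinearEquiv :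
      (E →L[ℝ] E →L[ℝ] ℝ) →L[ℝ] (E →L[ℝ] E →L[ℝ] ℝ)).comp (fderiv ℝ G y).flip) v) w z =
      fderiv ℝ G y z v w := rfl
  simp only [christoffelLow, smul_apply, sub_apply, add_apply, this, ContinuousLinearMap.flip_apply, smul_eq_mul]
  ring

theorem riemann_apply (G : E → E →L[ℝ] E →L[ℝ] ℝ) (y u v w : E) :
    riemann G y v w u =
      fderiv ℝ (christoffel G) y u v w - fderiv ℝ (christoffel G) y v u w
        + christoffel G y u (christoffel G y v w) - christoffel G y v (christoffel G y u w) := rfl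

theorem ricci_apply [FiniteDimensional ℝ E] (G : E → E →L[ℝ] E →L[ℝ] ℝ) (y v w : E) :
    ricci G y v w = traceCLM (riemann G y v w) := rfl

theorem metricTrace_eq [FiniteDimensional ℝ E] (b T : E →L[ℝ] E →L[ℝ] ℝ) :
    metricTrace b T = traceCLM ((sharp b).comp T) := rfl

/-! ### The Levi-Civita connection and the smoothness of the curvature -/

namespace IsMetricOn

variable [FiniteDimensional ℝ E] {G : E → E →L[ℝ] E →L[ℝ] ℝ} {U : Set E} {y : E}

theorem mem_nhds (hG : IsMetricOn G U) (hy : y ∈ U) : U ∈ nhds y := hG.isOpen.mem_nhds hy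

theorem differentiableAt (hG : IsMetricOn G U) (hy : y ∈ U) : DifferentiableAt ℝ G y :=
  (hG.contDiffOn.contDiffAt (hG.mem_nhds hy)).differentiableAt (by simp)

theorem isInvertible (hG : IsMetricOn G U) (hy : y ∈ U) : (G y).IsInvertible := by
  have hinj : Function.Injective (G y) := by
    rw [injective_iff_map_eq_zero]
    exact fun v hv ↦ hG.nondegenerate y hy v fun w ↦ by simp [hv]
  have hrank : Module.finrank ℝ E = Module.finrank ℝ (E →L[ℝ] ℝ) := by
    rw [← (LinearMap.toContinuousLinearMap (𝕜 := ℝ) (E := E) (F' := ℝ)).finrank_eq]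
    exact Subspace.dual_finrank_eq.symm
  exact ⟨(LinearEquiv.ofInjectiveOfFinrankEq (G y : E →ₗ[ℝ] E →L[ℝ] ℝ) hinj
    hrank).toContinuousLinearEquiv, rfl⟩

theorem sharp_apply (hG : IsMetricOn G U) (hy : y ∈ U) (v : E) : sharp (G y) (G y v) = v :=
  (hG.isInvertible hy).inverse_apply_eq.2 rfl

theorem apply_sharp (hG : IsMetricOn G U) (hy : y ∈ U) (θ : E →L[ℝ] ℝ) :
    G y (sharp (G y) θ) = θ :=
  ((hG.isInvertible hy).inverse_apply_eq.1 rfl).symm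

theorem eq_of_apply_eq (hG : IsMetricOn G U) (hy : y ∈ U) {v w : E}
    (h : ∀ z, G y v z = G y w z) : v = w :=
  sub_eq_zero.1 <| hG.nondegenerate y hy _ fun z ↦ by simp [h z]

theorem contDiffOn_sharp (hG : IsMetricOn G U) : ContDiffOn ℝ ∞ (fun z ↦ sharp (G z)) U :=
  fun z hz ↦ ((hG.isInvertible hz).contDiffAt_map_inverse.comp z
    (hG.contDiffOn.contDiffAt (hG.mem_nhds hz))).contDiffWithinAt

theorem contDiffOn_fderiv (hG : IsMetricOn G U) : ContDiffOn ℝ ∞ (fderiv ℝ G) U :=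
  hG.contDiffOn.fderiv_of_isOpen hG.isOpen (by simp)

theorem apply_christoffel (hG : IsMetricOn G U) (hy : y ∈ U) (v w z : E) :
    G y (christoffel G y v w) z =
      (fderiv ℝ G y v w z + fderiv ℝ G y w v z - fderiv ℝ G y z v w) / 2 := by
  rw [← christoffelLow_apply]
  exact DFunLike.congr_fun (hG.apply_sharp hy (christoffelLow G y v w)) z

theorem fderiv_symm (hG : IsMetricOn G U) (hy : y ∈ U) (u v w : E) :
    fderiv ℝ G y u v w = fderiv ℝ G y u w v := by
  rw [← fderiv_clm_apply_const₂ (hG.differentiableAt hy),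
    ← fderiv_clm_apply_const₂ (hG.differentiableAt hy)]
  have : (fun z ↦ G z v w) =ᶠ[nhds y] fun z ↦ G z w v :=
    Filter.eventuallyEq_of_mem (hG.mem_nhds hy) fun z hz ↦ hG.symm z hz v w
  rw [this.fderiv_eq]

theorem christoffel_comm (hG : IsMetricOn G U) (hy : y ∈ U) (v w : E) :
    christoffel G y v w = christoffel G y w v := by
  refine hG.eq_of_apply_eq hy fun z ↦ ?_
  rw [hG.apply_christoffel hy, hG.apply_christoffel hy, hG.fderiv_symm hy z v w]
  ring

/-- The Koszul formula determines the connection by nondegeneracy; a guessed expression is thus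
verified by pairing it with every vector. -/
theorem christoffel_eq (hG : IsMetricOn G U) (hy : y ∈ U) {v w c : E}
    (h : ∀ z, G y c z =
      (fderiv ℝ G y v w z + fderiv ℝ G y w v z - fderiv ℝ G y z v w) / 2) :
    christoffel G y v w = c :=
  hG.eq_of_apply_eq hy fun z ↦ by rw [hG.apply_christoffel hy, h]

/-- The Levi-Civita connection is metric. -/
theorem fderiv_apply (hG : IsMetricOn G U) (hy : y ∈ U) (u v w : E) :
    fderiv ℝ G y u v w = G y (christoffel G y u v) w + G y v (christoffel G y u w) := by
  rw [hG.symm y hy v, hG.apply_christoffel hy, hG.apply_christoffel hy,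
    hG.fderiv_symm hy u w v]
  ring

theorem contDiffOn_christoffel (hG : IsMetricOn G U) : ContDiffOn ℝ ∞ (christoffel G) U := by
  rw [contDiffOn_clm_apply₂]
  intro v w
  have h : ContDiffOn ℝ ∞ (fun z ↦ christoffelLow G z v w) U := by
    rw [contDiffOn_clm_apply]
    intro x
    simp only [christoffelLow_apply]
    have := hG.contDiffOn_fderiv
    refine ContDiffOn.div_const (.sub (.add ?_ ?_) ?_) _ <;>
    exact ((this.clm_apply contDiffOn_const).clm_apply contDiffOn_const).clm_apply
      contDiffOn_const
  exact hG.contDiffOn_sharp.clm_apply h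

theorem differentiableAt_christoffel (hG : IsMetricOn G U) (hy : y ∈ U) :
    DifferentiableAt ℝ (christoffel G) y :=
  (hG.contDiffOn_christoffel.contDiffAt (hG.mem_nhds hy)).differentiableAt (by simp)

theorem contDiffOn_riemann (hG : IsMetricOn G U) (v w : E) :
    ContDiffOn ℝ ∞ (fun z ↦ riemann G z v w) U := by
  rw [contDiffOn_clm_apply]
  intro u
  simp only [riemann_apply]
  have h := hG.contDiffOn_christoffel
  have h' : ContDiffOn ℝ ∞ (fderiv ℝ (christoffel G)) U :=
    h.fderiv_of_isOpen hG.isOpen (by simp)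
  have h0 : ∀ a b, ContDiffOn ℝ ∞ (fun z ↦ christoffel G z a b) U := contDiffOn_clm_apply₂.1 h
  have hc : ∀ a : E, ContDiffOn ℝ ∞ (fun _ : E ↦ a) U := fun a ↦ contDiffOn_const
  exact (((((h'.clm_apply (hc u)).clm_apply (hc v)).clm_apply (hc w)).sub
    (((h'.clm_apply (hc v)).clm_apply (hc u)).clm_apply (hc w))).add
    ((h.clm_apply (hc u)).clm_apply (h0 v w))).sub ((h.clm_apply (hc v)).clm_apply (h0 u w))

theorem contDiffOn_ricci (hG : IsMetricOn G U) : ContDiffOn ℝ ∞ (ricci G) U := by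
  rw [contDiffOn_clm_apply₂]
  intro v w
  simp only [ricci_apply]
  exact (traceCLM (E := E)).contDiff.comp_contDiffOn (hG.contDiffOn_riemann v w)

theorem contDiffOn_scal (hG : IsMetricOn G U) : ContDiffOn ℝ ∞ (scal G) U :=
  (traceCLM (E := E)).contDiff.comp_contDiffOn (hG.contDiffOn_sharp.clm_comp hG.contDiffOn_ricci)

end IsMetricOn

end Coord

/-! ### Contracted Christoffel symbols, the Ricci tensor and the tensor `L` -/

namespace Coord

variable {E : Type*} [NormedAddCommGroup E] [NormedSpace ℝ E]

namespace IsMetricOn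

variable [FiniteDimensional ℝ E] {G : E → E →L[ℝ] E →L[ℝ] ℝ} {U : Set E} {y : E}

theorem differentiableAt_sharp (hG : IsMetricOn G U) (hy : y ∈ U) :
    DifferentiableAt ℝ (fun z ↦ sharp (G z)) y :=
  (hG.contDiffOn_sharp.contDiffAt (hG.mem_nhds hy)).differentiableAt (by simp)

/-- Differentiate the identity `G⁻¹ G x = x` with `x` fixed. -/
theorem fderiv_sharp (hG : IsMetricOn G U) (hy : y ∈ U) (v : E) :
    fderiv ℝ (fun z ↦ sharp (G z)) y v =
      -((sharp (G y)).comp ((fderiv ℝ G y v).comp (sharp (G y)))) := by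
  ext θ
  obtain ⟨x, rfl⟩ : ∃ x, θ = G y x := ⟨_, (hG.apply_sharp hy θ).symm⟩
  have h : (fun z ↦ sharp (G z) (G z x)) =ᶠ[nhds y] fun _ ↦ x :=
    Filter.eventuallyEq_of_mem (hG.mem_nhds hy) fun z hz ↦ hG.sharp_apply hz x
  have h' := h.fderiv_eq (𝕜 := ℝ)
  rw [fderiv_clm_apply (hG.differentiableAt_sharp hy)
    ((hG.differentiableAt hy).clm_apply (differentiableAt_const x))] at h'
  have h'' := DFunLike.congr_fun h' v
  simp only [add_apply, ContinuousLinearMap.comp_apply, ContinuousLinearMap.flip_apply,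
    fderiv_clm_apply_const (hG.differentiableAt hy), fderiv_fun_const, Pi.zero_apply,
    zero_apply] at h''
  simp only [neg_apply, ContinuousLinearMap.comp_apply, hG.sharp_apply hy]
  exact eq_neg_of_add_eq_zero_right h''

/-- By the Koszul formula, `Γ_w - G⁻¹ ∂_w G / 2` comes from the part antisymmetric in the two other
arguments; it is skew for `G`, hence traceless. -/
theorem traceCLM_christoffel (hG : IsMetricOn G U) (hy : y ∈ U) (w : E) :
    traceCLM (christoffel G y w) = traceCLM ((sharp (G y)).comp (fderiv ℝ G y w)) / 2 := by
  have h := traceCLM_eq_zero_of_skew (G y) (hG.nondegenerate y hy)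
    (christoffel G y w - (1 / 2 : ℝ) • (sharp (G y)).comp (fderiv ℝ G y w)) (fun u x ↦ by
      rw [hG.symm y hy u]
      simp only [sub_apply, smul_apply, ContinuousLinearMap.comp_apply, map_sub, map_smul,
        hG.apply_christoffel hy, hG.apply_sharp hy, smul_eq_mul]
      rw [hG.fderiv_symm hy w x u]
      ring)
  rw [map_sub, map_smul, smul_eq_mul] at h
  linarith

theorem differentiableAt_fderiv (hG : IsMetricOn G U) (hy : y ∈ U) :
    DifferentiableAt ℝ (fderiv ℝ G) y := by
  exact (hG.contDiffOn_fderiv.contDiffAt (hG.mem_nhds hy)).differentiableAt (by simp)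

theorem fderiv_fderiv_symm (hG : IsMetricOn G U) (hy : y ∈ U) (v w : E) :
    fderiv ℝ (fderiv ℝ G) y v w = fderiv ℝ (fderiv ℝ G) y w v :=
  ((hG.contDiffOn.contDiffAt (hG.mem_nhds hy)).isSymmSndFDerivAt (by
    rw [minSmoothness_of_isRCLikeNormedField]; exact WithTop.coe_le_coe.2 (le_top : (2 : ℕ∞) ≤ ⊤))) v w

/-- The contracted Christoffel symbols form a closed one-form. -/
theorem fderiv_traceCLM_christoffel_comm (hG : IsMetricOn G U) (hy : y ∈ U) (v w : E) :
    fderiv ℝ (fun z ↦ traceCLM (christoffel G z w)) y v =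
      fderiv ℝ (fun z ↦ traceCLM (christoffel G z v)) y w := by
  -- The right-hand side is symmetric in `v` and `w`: second derivatives commute, and so do two
  -- factors under the trace.
  have key : ∀ v w, fderiv ℝ (fun z ↦ traceCLM (christoffel G z w)) y v =
      (traceCLM ((sharp (G y)).comp (fderiv ℝ (fderiv ℝ G) y v w)) -
      traceCLM (((sharp (G y)).comp (fderiv ℝ G y v)).comp
        ((sharp (G y)).comp (fderiv ℝ G y w)))) / 2 := by
    intro v w
    have h : (fun z ↦ traceCLM (christoffel G z w)) =ᶠ[nhds y]
        fun z ↦ (1 / 2 : ℝ) • traceCLM ((sharp (G z)).comp (fderiv ℝ G z w)) :=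
      Filter.eventuallyEq_of_mem (hG.mem_nhds hy) fun z hz ↦ by
        rw [hG.traceCLM_christoffel hz, smul_eq_mul]
        ring
    have h1 : HasFDerivAt (fun z ↦ fderiv ℝ G z w) ((fderiv ℝ (fderiv ℝ G) y).flip w) y := by
      have := (hG.differentiableAt_fderiv hy).hasFDerivAt.clm_apply (hasFDerivAt_const w y)
      simpa using this
    have h2 := (hG.differentiableAt_sharp hy).hasFDerivAt.clm_comp h1
    have h3 := (((traceCLM (E := E)).hasFDerivAt.comp y h2).const_smul (1 / 2 : ℝ)).fderiv
    rw [h.fderiv_eq]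
    refine (DFunLike.congr_fun h3 v).trans ?_
    simp only [smul_apply, ContinuousLinearMap.comp_apply, add_apply,
      ContinuousLinearMap.compL_apply, ContinuousLinearMap.flip_apply, hG.fderiv_sharp hy,
      map_add, map_neg, ContinuousLinearMap.comp_assoc, smul_eq_mul]
    ring
  rw [key, key, hG.fderiv_fderiv_symm hy v w,
    traceCLM_comp_comm ((sharp (G y)).comp (fderiv ℝ G y v))]

/-- The classical contracted formula: only a divergence and traces of Christoffel symbols occur, and
each of these splits over a direct sum. The full curvature tensor of the product is never needed. -/
theorem ricci_eq (hG : IsMetricOn G U) (hy : y ∈ U) (v w : E) :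
    ricci G y v w = traceCLM (fderiv ℝ (fun z ↦ christoffel G z v w) y)
      - fderiv ℝ (fun z ↦ traceCLM (christoffel G z w)) y v
      + traceCLM (christoffel G y (christoffel G y v w))
      - traceCLM ((christoffel G y v).comp (christoffel G y w)) := by
  have hd := hG.differentiableAt_christoffel hy
  have h1 : fderiv ℝ (fun z ↦ traceCLM (christoffel G z w)) y v =
      traceCLM (fderiv ℝ (christoffel G) y v w) := by
    have h : HasFDerivAt (fun z ↦ christoffel G z w) ((fderiv ℝ (christoffel G) y).flip w) y := by
      simpa using hd.hasFDerivAt.clm_apply (hasFDerivAt_const w y)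
    exact DFunLike.congr_fun ((traceCLM (E := E)).hasFDerivAt.comp y h).fderiv v
  -- Symmetry of `Γ` moves the traced variable `u` to the last slot, so that the term becomes the
  -- derivative of the endomorphism `Γ_w`.
  have h2 : ∀ u, fderiv ℝ (christoffel G) y v u w = fderiv ℝ (christoffel G) y v w u := by
    intro u
    rw [← fderiv_clm_apply_const₂ hd, ← fderiv_clm_apply_const₂ hd]
    have : (fun z ↦ christoffel G z u w) =ᶠ[nhds y] fun z ↦ christoffel G z w u :=
      Filter.eventuallyEq_of_mem (hG.mem_nhds hy) fun z hz ↦ hG.christoffel_comm hz u w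
    rw [this.fderiv_eq]
  rw [ricci_apply, h1, ← map_sub, ← map_add, ← map_sub]
  congr 1
  ext u
  simp only [riemann_apply, sub_apply, add_apply, ContinuousLinearMap.comp_apply,
    fderiv_clm_apply_const₂ hd, h2, hG.christoffel_comm hy u]

/-- The Ricci tensor is symmetric. -/
theorem ricci_symm (hG : IsMetricOn G U) (hy : y ∈ U) (v w : E) :
    ricci G y v w = ricci G y w v := by
  have : (fun z ↦ christoffel G z v w) =ᶠ[nhds y] fun z ↦ christoffel G z w v :=
    Filter.eventuallyEq_of_mem (hG.mem_nhds hy) fun z hz ↦ hG.christoffel_comm hz v w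
  rw [hG.ricci_eq hy, hG.ricci_eq hy, this.fderiv_eq, hG.fderiv_traceCLM_christoffel_comm hy,
    hG.christoffel_comm hy v w, traceCLM_comp_comm]

theorem differentiableAt_ricci (hG : IsMetricOn G U) (hy : y ∈ U) :
    DifferentiableAt ℝ (ricci G) y :=
  (hG.contDiffOn_ricci.contDiffAt (hG.mem_nhds hy)).differentiableAt (by simp)

theorem differentiableAt_scal (hG : IsMetricOn G U) (hy : y ∈ U) :
    DifferentiableAt ℝ (scal G) y :=
  (hG.contDiffOn_scal.contDiffAt (hG.mem_nhds hy)).differentiableAt (by simp)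

theorem hasFDerivAt_scal_div (hG : IsMetricOn G U) (hy : y ∈ U) :
    HasFDerivAt (fun z ↦ 2 * scal G z / ((Module.finrank ℝ E : ℝ) + 2))
      ((2 / ((Module.finrank ℝ E : ℝ) + 2)) • fderiv ℝ (scal G) y) y := by
  have := (hG.differentiableAt_scal hy).hasFDerivAt.const_mul
    (2 / ((Module.finrank ℝ E : ℝ) + 2))
  refine this.congr_of_eventuallyEq (.of_forall fun z ↦ ?_)
  simp only
  ring

/-- The metric is parallel, so only the scalar factor of the second term of `L` is differentiated.
-/
theorem covDeriv_tensorL (hG : IsMetricOn G U) (hy : y ∈ U) (u v w : E) :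
    covDeriv G (tensorL G) y u v w = covDeriv G (ricci G) y u v w -
      2 / ((Module.finrank ℝ E : ℝ) + 2) * fderiv ℝ (scal G) y u * G y v w := by
  have h2 := ((hG.differentiableAt_ricci hy).hasFDerivAt.fun_sub
    ((hG.hasFDerivAt_scal_div hy).fun_smul (hG.differentiableAt hy).hasFDerivAt)).fderiv
  have h3 : fderiv ℝ (tensorL G) y u v w = fderiv ℝ (ricci G) y u v w -
      (2 * scal G y / ((Module.finrank ℝ E : ℝ) + 2) * fderiv ℝ G y u v w +
      2 / ((Module.finrank ℝ E : ℝ) + 2) * fderiv ℝ (scal G) y u * G y v w) := by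
    refine (congrArg (fun A : E →L[ℝ] E →L[ℝ] E →L[ℝ] ℝ ↦ A u v w) h2).trans ?_
    simp
  rw [covDeriv, covDeriv, h3, hG.fderiv_apply hy]
  simp only [tensorL, sub_apply, smul_apply, smul_eq_mul]
  ring

theorem tensorL_symm (hG : IsMetricOn G U) (hy : y ∈ U) (v w : E) :
    tensorL G y v w = tensorL G y w v := by
  simp only [tensorL, sub_apply, smul_apply, hG.symm y hy v w, hG.ricci_symm hy v w]

theorem differentiableAt_tensorL (hG : IsMetricOn G U) (hy : y ∈ U) :
    DifferentiableAt ℝ (tensorL G) y :=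
  (hG.differentiableAt_ricci hy).fun_sub
    ((hG.hasFDerivAt_scal_div hy).differentiableAt.fun_smul (hG.differentiableAt hy))

theorem covDeriv_tensorL_symm (hG : IsMetricOn G U) (hy : y ∈ U) (u v w : E) :
    covDeriv G (tensorL G) y u v w = covDeriv G (tensorL G) y u w v := by
  have hd := hG.differentiableAt_tensorL hy
  have : (fun z ↦ tensorL G z v w) =ᶠ[nhds y] fun z ↦ tensorL G z w v :=
    Filter.eventuallyEq_of_mem (hG.mem_nhds hy) fun z hz ↦ hG.tensorL_symm hz v w
  rw [covDeriv, covDeriv, ← fderiv_clm_apply_const₂ hd, ← fderiv_clm_apply_const₂ hd,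
    this.fderiv_eq, hG.tensorL_symm hy v, hG.tensorL_symm hy _ w]
  ring

/-- A cubic form determines its symmetrization. As `D L` is symmetric in its last two arguments, the
sum over all permutations is twice the cyclic sum. -/
theorem cyclic_covDeriv_tensorL_eq_zero_iff (hG : IsMetricOn G U) (hy : y ∈ U) :
    (∀ u v w, covDeriv G (tensorL G) y u v w + covDeriv G (tensorL G) y v w u +
      covDeriv G (tensorL G) y w u v = 0) ↔ ∀ u, covDeriv G (tensorL G) y u u u = 0 := by
  refine ⟨fun h u ↦ by linarith [h u u u], fun h u v w ↦ ?_⟩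
  have hs := hG.covDeriv_tensorL_symm hy
  have add₁ : ∀ a b v w, covDeriv G (tensorL G) y (a + b) v w =
      covDeriv G (tensorL G) y a v w + covDeriv G (tensorL G) y b v w := fun a b v w ↦ by
    simp only [covDeriv, map_add, add_apply]
    ring
  have add₂ : ∀ u a b w, covDeriv G (tensorL G) y u (a + b) w =
      covDeriv G (tensorL G) y u a w + covDeriv G (tensorL G) y u b w := fun u a b w ↦ by
    simp only [covDeriv, map_add, add_apply]
    ring
  have add₃ : ∀ u v a b, covDeriv G (tensorL G) y u v (a + b) =
      covDeriv G (tensorL G) y u v a + covDeriv G (tensorL G) y u v b := fun u v a b ↦ by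
    rw [hs, add₂, hs _ a, hs _ b]
  -- Inclusion-exclusion over the partial sums isolates the part linear in each of `u`, `v`, `w`.
  have h1 := h (u + v + w)
  have h2 := h (u + v)
  have h3 := h (u + w)
  have h4 := h (v + w)
  simp only [add₁, add₂, add₃, h] at h1 h2 h3 h4
  rw [hs u w v, hs v u w, hs w v u] at h1
  linarith

/-! ### Hessian, gradient and Laplacian -/

section Hessian

variable {f : E → ℝ}

/-- The Hessian is the covariant derivative of the gradient. -/
theorem sharp_hessian (hG : IsMetricOn G U) (hf : ContDiffOn ℝ ∞ f U) (hy : y ∈ U) (u : E) :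
    sharp (G y) (hessian G f y u) =
      fderiv ℝ (fun z ↦ sharp (G z) (fderiv ℝ f z)) y u +
        christoffel G y u (sharp (G y) (fderiv ℝ f y)) := by
  have hdf : DifferentiableAt ℝ (fderiv ℝ f) y :=
    ((hf.fderiv_of_isOpen (m := ∞) hG.isOpen (by simp)).contDiffAt
      (hG.mem_nhds hy)).differentiableAt (by simp)
  have hgr : DifferentiableAt ℝ (fun z ↦ sharp (G z) (fderiv ℝ f z)) y :=
    (hG.differentiableAt_sharp hy).clm_apply hdf
  refine hG.eq_of_apply_eq hy fun x ↦ ?_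
  have h : (fun z ↦ G z (sharp (G z) (fderiv ℝ f z)) x) =ᶠ[nhds y] fun z ↦ fderiv ℝ f z x :=
    Filter.eventuallyEq_of_mem (hG.mem_nhds hy) fun z hz ↦ by
      rw [hG.apply_sharp hz]
  have h' := DFunLike.congr_fun (h.fderiv_eq (𝕜 := ℝ)) u
  rw [fderiv_clm_apply₂ (hG.differentiableAt hy) hgr (differentiableAt_const x),
    fderiv_clm_apply_const hdf, hG.fderiv_apply hy, hG.apply_sharp hy] at h'
  rw [hG.apply_sharp hy, map_add, add_apply, hessian, sub_apply, sub_apply, ← h']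
  simp
  ring

/-- The Laplacian is the divergence of the gradient. In this form it can be recognized among the
traces produced by `ricci_eq`. -/
theorem laplacian_eq (hG : IsMetricOn G U) (hf : ContDiffOn ℝ ∞ f U) (hy : y ∈ U) :
    laplacian G f y = traceCLM (fderiv ℝ (fun z ↦ sharp (G z) (fderiv ℝ f z)) y) +
      traceCLM (christoffel G y (sharp (G y) (fderiv ℝ f y))) := by
  rw [laplacian, metricTrace_eq, ← map_add]
  congr 1
  ext u
  rw [ContinuousLinearMap.comp_apply, hG.sharp_hessian hf hy, add_apply,
    hG.christoffel_comm hy u]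

end Hessian

end IsMetricOn

end Coord

/-! ### The connection of a doubly warped product -/

namespace Coord

variable {E₁ E₂ F : Type*} [NormedAddCommGroup E₁] [NormedSpace ℝ E₁]
  [NormedAddCommGroup E₂] [NormedSpace ℝ E₂] [NormedAddCommGroup F] [NormedSpace ℝ F]

/-- The gradient of `f`. -/
def gradient (G : E₁ → E₁ →L[ℝ] E₁ →L[ℝ] ℝ) (f : E₁ → ℝ) (y : E₁) : E₁ :=
  sharp (G y) (fderiv ℝ f y)

theorem IsMetricOn.apply_gradient [FiniteDimensional ℝ E₁] {G : E₁ → E₁ →L[ℝ] E₁ →L[ℝ] ℝ}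
    {U : Set E₁} {y : E₁} (hG : IsMetricOn G U) (hy : y ∈ U) (f : E₁ → ℝ) (v : E₁) :
    G y (gradient G f y) v = fderiv ℝ f y v := by
  rw [gradient, hG.apply_sharp hy]

theorem IsMetricOn.apply_gradient_right [FiniteDimensional ℝ E₁]
    {G : E₁ → E₁ →L[ℝ] E₁ →L[ℝ] ℝ} {U : Set E₁} {y : E₁} (hG : IsMetricOn G U) (hy : y ∈ U)
    (f : E₁ → ℝ) (v : E₁) : G y v (gradient G f y) = fderiv ℝ f y v := by
  rw [hG.symm y hy, hG.apply_gradient hy]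

/-- The space `F` is the direct sum of `E₁` and `E₂`, and `G` is on `U` the doubly warped product
of the metrics `G₁` and `G₂` with warping functions `a` and `b`. -/
structure IsDoublyWarpedOn (p₁ : F →L[ℝ] E₁) (p₂ : F →L[ℝ] E₂) (i₁ : E₁ →L[ℝ] F)
    (i₂ : E₂ →L[ℝ] F) (G₁ : E₁ → E₁ →L[ℝ] E₁ →L[ℝ] ℝ) (G₂ : E₂ → E₂ →L[ℝ] E₂ →L[ℝ] ℝ)
    (a : E₁ → ℝ) (b : E₂ → ℝ) (U₁ : Set E₁) (U₂ : Set E₂)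
    (G : F → F →L[ℝ] F →L[ℝ] ℝ) (U : Set F) : Prop where
  fst_inl : ∀ x, p₁ (i₁ x) = x
  snd_inl : ∀ x, p₂ (i₁ x) = 0
  fst_inr : ∀ x, p₁ (i₂ x) = 0
  snd_inr : ∀ x, p₂ (i₂ x) = x
  add_eq : ∀ z, i₁ (p₁ z) + i₂ (p₂ z) = z
  metric₁ : IsMetricOn G₁ U₁
  metric₂ : IsMetricOn G₂ U₂
  contDiffOn₁ : ContDiffOn ℝ ∞ a U₁
  contDiffOn₂ : ContDiffOn ℝ ∞ b U₂
  ne_zero₁ : ∀ x ∈ U₁, a x ≠ 0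
  ne_zero₂ : ∀ x ∈ U₂, b x ≠ 0
  isOpen : IsOpen U
  fst_mem : ∀ z ∈ U, p₁ z ∈ U₁
  snd_mem : ∀ z ∈ U, p₂ z ∈ U₂
  metric_apply : ∀ z ∈ U, ∀ v w, G z v w =
    b (p₂ z) ^ 2 * G₁ (p₁ z) (p₁ v) (p₁ w) + a (p₁ z) ^ 2 * G₂ (p₂ z) (p₂ v) (p₂ w)

namespace IsDoublyWarpedOn

variable [FiniteDimensional ℝ E₁] [FiniteDimensional ℝ E₂] [FiniteDimensional ℝ F]
  {p₁ : F →L[ℝ] E₁} {p₂ : F →L[ℝ] E₂} {i₁ : E₁ →L[ℝ] F}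
  {i₂ : E₂ →L[ℝ] F} {G₁ : E₁ → E₁ →L[ℝ] E₁ →L[ℝ] ℝ} {G₂ : E₂ → E₂ →L[ℝ] E₂ →L[ℝ] ℝ}
  {a : E₁ → ℝ} {b : E₂ → ℝ} {U₁ : Set E₁} {U₂ : Set E₂}
  {G : F → F →L[ℝ] F →L[ℝ] ℝ} {U : Set F} {y : F}

/-- The roles of the two factors may be exchanged. -/
theorem swap (h : IsDoublyWarpedOn p₁ p₂ i₁ i₂ G₁ G₂ a b U₁ U₂ G U) :
    IsDoublyWarpedOn p₂ p₁ i₂ i₁ G₂ G₁ b a U₂ U₁ G U where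
  fst_inl := h.snd_inr
  snd_inl := h.fst_inr
  fst_inr := h.snd_inl
  snd_inr := h.fst_inl
  add_eq z := by rw [add_comm, h.add_eq]
  metric₁ := h.metric₂
  metric₂ := h.metric₁
  contDiffOn₁ := h.contDiffOn₂
  contDiffOn₂ := h.contDiffOn₁
  ne_zero₁ := h.ne_zero₂
  ne_zero₂ := h.ne_zero₁
  isOpen := h.isOpen
  fst_mem := h.snd_mem
  snd_mem := h.fst_mem
  metric_apply z hz v w := by rw [add_comm, h.metric_apply z hz]

theorem isMetricOn (h : IsDoublyWarpedOn p₁ p₂ i₁ i₂ G₁ G₂ a b U₁ U₂ G U) : IsMetricOn G U where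
  isOpen := h.isOpen
  contDiffOn := by
    rw [contDiffOn_clm_apply₂]
    intro v w
    have hp₁ : ContDiffOn ℝ ∞ p₁ U := p₁.contDiff.contDiffOn
    have hp₂ : ContDiffOn ℝ ∞ p₂ U := p₂.contDiff.contDiffOn
    refine ContDiffOn.congr (.add (.mul (.pow (h.contDiffOn₂.comp hp₂ h.snd_mem) 2)
      ((contDiffOn_clm_apply₂.1 h.metric₁.contDiffOn (p₁ v) (p₁ w)).comp hp₁ h.fst_mem))
      (.mul (.pow (h.contDiffOn₁.comp hp₁ h.fst_mem) 2)
      ((contDiffOn_clm_apply₂.1 h.metric₂.contDiffOn (p₂ v) (p₂ w)).comp hp₂ h.snd_mem)))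
      fun z hz ↦ h.metric_apply z hz v w
  symm z hz v w := by
    rw [h.metric_apply z hz, h.metric_apply z hz, h.metric₁.symm _ (h.fst_mem z hz),
      h.metric₂.symm _ (h.snd_mem z hz)]
  nondegenerate z hz v hv := by
    have ha := h.ne_zero₁ _ (h.fst_mem z hz)
    have hb := h.ne_zero₂ _ (h.snd_mem z hz)
    have h₁ : p₁ v = 0 := h.metric₁.nondegenerate _ (h.fst_mem z hz) _ fun w ↦ by
      simpa [h.metric_apply z hz, h.fst_inl, h.snd_inl, hb] using hv (i₁ w)
    have h₂ : p₂ v = 0 := h.metric₂.nondegenerate _ (h.snd_mem z hz) _ fun w ↦ by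
      simpa [h.metric_apply z hz, h.fst_inr, h.snd_inr, ha] using hv (i₂ w)
    rw [← h.add_eq v, h₁, h₂, map_zero, map_zero, add_zero]

theorem traceCLM_eq (h : IsDoublyWarpedOn p₁ p₂ i₁ i₂ G₁ G₂ a b U₁ U₂ G U) (A : F →L[ℝ] F) :
    traceCLM A = traceCLM (p₁.comp (A.comp i₁)) + traceCLM (p₂.comp (A.comp i₂)) := by
  rw [traceCLM_comp_comm p₁, traceCLM_comp_comm p₂, ContinuousLinearMap.comp_assoc,
    ContinuousLinearMap.comp_assoc, ← map_add, ← ContinuousLinearMap.comp_add]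
  congr 1
  ext z
  simp only [add_apply, ContinuousLinearMap.comp_apply]
  rw [h.add_eq]

/-- An identity valid on `U` holds near `p₁ y` along the slice through `y`, so it may be
differentiated there. -/
theorem slice_mem (h : IsDoublyWarpedOn p₁ p₂ i₁ i₂ G₁ G₂ a b U₁ U₂ G U) (hy : y ∈ U) :
    ∀ᶠ x in nhds (p₁ y), i₁ x + i₂ (p₂ y) ∈ U := by
  have : Filter.Tendsto (fun x ↦ i₁ x + i₂ (p₂ y)) (nhds (p₁ y)) (nhds y) := by
    have hc : Continuous fun x ↦ i₁ x + i₂ (p₂ y) := by fun_prop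
    simpa [h.add_eq] using hc.tendsto (p₁ y)
  exact this (h.isOpen.mem_nhds hy)

/-- The partial derivative in the direction of the first factor. -/
theorem fderiv_comp_inl (h : IsDoublyWarpedOn p₁ p₂ i₁ i₂ G₁ G₂ a b U₁ U₂ G U)
    {V : Type*} [NormedAddCommGroup V] [NormedSpace ℝ V] {f : F → V}
    (hf : DifferentiableAt ℝ f y) :
    (fderiv ℝ f y).comp i₁ = fderiv ℝ (fun x ↦ f (i₁ x + i₂ (p₂ y))) (p₁ y) := by
  have h1 : HasFDerivAt (fun x ↦ i₁ x + i₂ (p₂ y)) i₁ (p₁ y) := i₁.hasFDerivAt.add_const _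
  have h2 : HasFDerivAt f (fderiv ℝ f y) (i₁ (p₁ y) + i₂ (p₂ y)) := by
    rw [h.add_eq]
    exact hf.hasFDerivAt
  exact (h2.comp (p₁ y) h1).fderiv.symm

theorem differentiableAt₁ (h : IsDoublyWarpedOn p₁ p₂ i₁ i₂ G₁ G₂ a b U₁ U₂ G U)
    (hy : y ∈ U) : DifferentiableAt ℝ a (p₁ y) :=
  (h.contDiffOn₁.contDiffAt (h.metric₁.mem_nhds (h.fst_mem y hy))).differentiableAt (by simp)

theorem contDiffOn_fderiv₁ (h : IsDoublyWarpedOn p₁ p₂ i₁ i₂ G₁ G₂ a b U₁ U₂ G U) :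
    ContDiffOn ℝ ∞ (fderiv ℝ a) U₁ :=
  h.contDiffOn₁.fderiv_of_isOpen h.metric₁.isOpen (by simp)

theorem differentiableAt_fderiv₁ (h : IsDoublyWarpedOn p₁ p₂ i₁ i₂ G₁ G₂ a b U₁ U₂ G U)
    (hy : y ∈ U) : DifferentiableAt ℝ (fderiv ℝ a) (p₁ y) :=
  (h.contDiffOn_fderiv₁.contDiffAt (h.metric₁.mem_nhds (h.fst_mem y hy))).differentiableAt
    (by simp)

theorem fderiv_metric (h : IsDoublyWarpedOn p₁ p₂ i₁ i₂ G₁ G₂ a b U₁ U₂ G U)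
    (hy : y ∈ U) (u v w : F) : fderiv ℝ G y u v w =
    2 * b (p₂ y) * fderiv ℝ b (p₂ y) (p₂ u) * G₁ (p₁ y) (p₁ v) (p₁ w)
    + b (p₂ y) ^ 2 * fderiv ℝ G₁ (p₁ y) (p₁ u) (p₁ v) (p₁ w)
    + 2 * a (p₁ y) * fderiv ℝ a (p₁ y) (p₁ u) * G₂ (p₂ y) (p₂ v) (p₂ w)
    + a (p₁ y) ^ 2 * fderiv ℝ G₂ (p₂ y) (p₂ u) (p₂ v) (p₂ w) := by
  have hd : DifferentiableAt ℝ (fun z ↦ G z v w) y :=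
    ((h.isMetricOn.differentiableAt hy).clm_apply (differentiableAt_const v)).clm_apply
      (differentiableAt_const w)
  have hd₁ := h.metric₁.differentiableAt (h.fst_mem y hy)
  have hd₂ := h.metric₂.differentiableAt (h.snd_mem y hy)
  have key : (fun z ↦ G z v w) =ᶠ[nhds y] fun z ↦
      b (p₂ z) ^ 2 * G₁ (p₁ z) (p₁ v) (p₁ w) + a (p₁ z) ^ 2 * G₂ (p₂ z) (p₂ v) (p₂ w) :=
    Filter.eventuallyEq_of_mem (h.isOpen.mem_nhds hy) fun z hz ↦ h.metric_apply z hz v w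
  have e₁ := ((hd₁.clm_apply (differentiableAt_const (p₁ v))).clm_apply
      (differentiableAt_const (p₁ w))).hasFDerivAt.comp y p₁.hasFDerivAt
  have e₂ := ((hd₂.clm_apply (differentiableAt_const (p₂ v))).clm_apply
      (differentiableAt_const (p₂ w))).hasFDerivAt.comp y p₂.hasFDerivAt
  have ea := (h.differentiableAt₁ hy).hasFDerivAt.comp y p₁.hasFDerivAt
  have eb := (h.swap.differentiableAt₁ hy).hasFDerivAt.comp y p₂.hasFDerivAt
  have e := ((eb.pow 2).mul e₁).add ((ea.pow 2).mul e₂)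
  rw [← fderiv_clm_apply_const₂ (h.isMetricOn.differentiableAt hy), key.fderiv_eq]
  refine (DFunLike.congr_fun e.fderiv u).trans ?_
  simp [fderiv_clm_apply_const₂ hd₁, fderiv_clm_apply_const₂ hd₂]
  ring

/-- Verified by the Koszul formula. Differentiating the warping factors gives the logarithmic
derivatives of `a` and `b` and, in the direction `z`, the gradient terms. -/
theorem christoffel_eq (h : IsDoublyWarpedOn p₁ p₂ i₁ i₂ G₁ G₂ a b U₁ U₂ G U)
    (hy : y ∈ U) (u v : F) : christoffel G y u v =
      i₁ (christoffel G₁ (p₁ y) (p₁ u) (p₁ v) + (fderiv ℝ b (p₂ y) (p₂ u) / b (p₂ y)) • p₁ v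
        + (fderiv ℝ b (p₂ y) (p₂ v) / b (p₂ y)) • p₁ u
        - (a (p₁ y) / b (p₂ y) ^ 2 * G₂ (p₂ y) (p₂ u) (p₂ v)) • gradient G₁ a (p₁ y))
      + i₂ (christoffel G₂ (p₂ y) (p₂ u) (p₂ v) + (fderiv ℝ a (p₁ y) (p₁ u) / a (p₁ y)) • p₂ v
        + (fderiv ℝ a (p₁ y) (p₁ v) / a (p₁ y)) • p₂ u
        - (b (p₂ y) / a (p₁ y) ^ 2 * G₁ (p₁ y) (p₁ u) (p₁ v)) • gradient G₂ b (p₂ y)) := by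
  have hy₁ := h.fst_mem y hy
  have hy₂ := h.snd_mem y hy
  have ha := h.ne_zero₁ _ hy₁
  have hb := h.ne_zero₂ _ hy₂
  refine h.isMetricOn.christoffel_eq hy fun z ↦ ?_
  simp only [h.metric_apply y hy, h.fderiv_metric hy, map_add, map_sub, map_smul, h.fst_inl,
    h.fst_inr, h.snd_inl, h.snd_inr, add_apply, sub_apply, smul_apply, smul_eq_mul, zero_apply,
    h.metric₁.apply_christoffel hy₁, h.metric₂.apply_christoffel hy₂,
    h.metric₁.apply_gradient hy₁, h.metric₂.apply_gradient hy₂, map_zero]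
  rw [h.metric₁.symm _ hy₁ (p₁ v) (p₁ z), h.metric₁.symm _ hy₁ (p₁ u) (p₁ z),
    h.metric₂.symm _ hy₂ (p₂ v) (p₂ z), h.metric₂.symm _ hy₂ (p₂ u) (p₂ z)]
  field_simp
  ring

theorem christoffel_inl_inl (h : IsDoublyWarpedOn p₁ p₂ i₁ i₂ G₁ G₂ a b U₁ U₂ G U)
    (hy : y ∈ U) (u v : E₁) : christoffel G y (i₁ u) (i₁ v) =
      i₁ (christoffel G₁ (p₁ y) u v)
        - (b (p₂ y) / a (p₁ y) ^ 2 * G₁ (p₁ y) u v) • i₂ (gradient G₂ b (p₂ y)) := by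
  rw [h.christoffel_eq hy]
  simp [h.fst_inl, h.snd_inl, sub_eq_add_neg]

theorem christoffel_inl_inr (h : IsDoublyWarpedOn p₁ p₂ i₁ i₂ G₁ G₂ a b U₁ U₂ G U)
    (hy : y ∈ U) (u : E₁) (v : E₂) : christoffel G y (i₁ u) (i₂ v) =
      (fderiv ℝ b (p₂ y) v / b (p₂ y)) • i₁ u + (fderiv ℝ a (p₁ y) u / a (p₁ y)) • i₂ v := by
  rw [h.christoffel_eq hy]
  simp [h.fst_inl, h.snd_inl, h.fst_inr, h.snd_inr]

theorem traceCLM_christoffel (h : IsDoublyWarpedOn p₁ p₂ i₁ i₂ G₁ G₂ a b U₁ U₂ G U)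
    (hy : y ∈ U) (w : F) : traceCLM (christoffel G y w) =
      traceCLM (christoffel G₁ (p₁ y) (p₁ w)) + traceCLM (christoffel G₂ (p₂ y) (p₂ w))
      + Module.finrank ℝ E₁ * (fderiv ℝ b (p₂ y) (p₂ w) / b (p₂ y))
      + Module.finrank ℝ E₂ * (fderiv ℝ a (p₁ y) (p₁ w) / a (p₁ y)) := by
  have h₁ : p₁.comp ((christoffel G y w).comp i₁) = christoffel G₁ (p₁ y) (p₁ w) +
      (fderiv ℝ b (p₂ y) (p₂ w) / b (p₂ y)) • ContinuousLinearMap.id ℝ E₁ := by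
    ext x
    simp [h.christoffel_eq hy, h.fst_inl, h.snd_inl, h.fst_inr]
  have h₂ : p₂.comp ((christoffel G y w).comp i₂) = christoffel G₂ (p₂ y) (p₂ w) +
      (fderiv ℝ a (p₁ y) (p₁ w) / a (p₁ y)) • ContinuousLinearMap.id ℝ E₂ := by
    ext x
    simp [h.christoffel_eq hy, h.snd_inl, h.fst_inr, h.snd_inr]
  rw [h.traceCLM_eq, h₁, h₂, map_add, map_add, map_smul, map_smul, traceCLM_id, traceCLM_id,
    smul_eq_mul, smul_eq_mul]
  ring

/-- The trace of `Γ_v ∘ Γ_w` for `v`, `w` tangent to the first factor. -/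
theorem traceCLM_christoffel_comp_inl_inl (h : IsDoublyWarpedOn p₁ p₂ i₁ i₂ G₁ G₂ a b U₁ U₂ G U)
    (hy : y ∈ U) (v w : E₁) :
    traceCLM ((christoffel G y (i₁ v)).comp (christoffel G y (i₁ w))) =
      traceCLM ((christoffel G₁ (p₁ y) v).comp (christoffel G₁ (p₁ y) w))
      + Module.finrank ℝ E₂ *
        (fderiv ℝ a (p₁ y) v * fderiv ℝ a (p₁ y) w / a (p₁ y) ^ 2)
      - 2 * (G₁ (p₁ y) v w * fderiv ℝ b (p₂ y) (gradient G₂ b (p₂ y)) / a (p₁ y) ^ 2) := by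
  have ha := h.ne_zero₁ _ (h.fst_mem y hy)
  have hb := h.ne_zero₂ _ (h.snd_mem y hy)
  -- The rank-one term is the passage through the second factor: `Γ_w` sends `x` to a multiple of
  -- `grad b`, and `Γ_v` sends `grad b` back to a multiple of `v`.
  have h₁ : p₁.comp (((christoffel G y (i₁ v)).comp (christoffel G y (i₁ w))).comp i₁) =
      (christoffel G₁ (p₁ y) v).comp (christoffel G₁ (p₁ y) w)
      - (fderiv ℝ b (p₂ y) (gradient G₂ b (p₂ y)) / a (p₁ y) ^ 2) •
        (G₁ (p₁ y) w).smulRight v := by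
    ext x
    simp only [ContinuousLinearMap.comp_apply, h.christoffel_inl_inl hy, map_sub, map_smul,
      h.christoffel_inl_inr hy, map_add, h.fst_inl, h.fst_inr, sub_apply,
      smul_apply, ContinuousLinearMap.smulRight_apply, smul_zero, sub_zero, add_zero, smul_smul]
    congr 2
    field_simp
  have h₂ : p₂.comp (((christoffel G y (i₁ v)).comp (christoffel G y (i₁ w))).comp i₂) =
      (fderiv ℝ a (p₁ y) v * fderiv ℝ a (p₁ y) w / a (p₁ y) ^ 2) • ContinuousLinearMap.id ℝ E₂
      - (G₁ (p₁ y) v w / a (p₁ y) ^ 2) •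
        (fderiv ℝ b (p₂ y)).smulRight (gradient G₂ b (p₂ y)) := by
    ext x
    simp only [ContinuousLinearMap.comp_apply, h.christoffel_inl_inl hy, map_sub, map_smul,
      h.christoffel_inl_inr hy, map_add, h.snd_inl, h.snd_inr, sub_apply,
      smul_apply, ContinuousLinearMap.smulRight_apply, smul_zero, zero_sub, zero_add, smul_smul,
      smul_neg, ContinuousLinearMap.id_apply, smul_add]
    rw [neg_add_eq_sub]
    congr 2 <;> field_simp
  rw [h.traceCLM_eq, h₁, h₂]
  simp only [map_sub, map_smul, traceCLM_id, traceCLM_smulRight, smul_eq_mul]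
  rw [h.metric₁.symm _ (h.fst_mem y hy) w v]
  ring

/-- The trace of `Γ_v ∘ Γ_w` for `v` tangent to the first and `w` to the second factor. -/
theorem traceCLM_christoffel_comp_inl_inr (h : IsDoublyWarpedOn p₁ p₂ i₁ i₂ G₁ G₂ a b U₁ U₂ G U)
    (hy : y ∈ U) (v : E₁) (w : E₂) :
    traceCLM ((christoffel G y (i₁ v)).comp (christoffel G y (i₂ w))) =
      fderiv ℝ b (p₂ y) w / b (p₂ y) * traceCLM (christoffel G₁ (p₁ y) v)
      + fderiv ℝ a (p₁ y) v / a (p₁ y) * traceCLM (christoffel G₂ (p₂ y) w)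
      + 2 * (fderiv ℝ a (p₁ y) v * fderiv ℝ b (p₂ y) w / (a (p₁ y) * b (p₂ y))) := by
  have hy₁ := h.fst_mem y hy
  have hy₂ := h.snd_mem y hy
  have ha := h.ne_zero₁ _ hy₁
  have hb := h.ne_zero₂ _ hy₂
  have hc : ∀ x, christoffel G y (i₂ w) (i₁ x) = (fderiv ℝ b (p₂ y) w / b (p₂ y)) • i₁ x
      + (fderiv ℝ a (p₁ y) x / a (p₁ y)) • i₂ w := fun x ↦ by
    rw [h.isMetricOn.christoffel_comm hy, h.christoffel_inl_inr hy]
  -- Each diagonal block has a rank-one term of trace `∂_v a ∂_w b / (a b)`; together they give the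
  -- coefficient 2.
  have h₁ : p₁.comp (((christoffel G y (i₁ v)).comp (christoffel G y (i₂ w))).comp i₁) =
      (fderiv ℝ b (p₂ y) w / b (p₂ y)) • christoffel G₁ (p₁ y) v
      + (fderiv ℝ b (p₂ y) w / (a (p₁ y) * b (p₂ y))) • (fderiv ℝ a (p₁ y)).smulRight v := by
    ext x
    simp only [ContinuousLinearMap.comp_apply, h.christoffel_inl_inl hy, map_sub, map_smul, hc,
      h.christoffel_inl_inr hy, map_add, h.fst_inl, h.fst_inr, add_apply,
      smul_apply, ContinuousLinearMap.smulRight_apply, smul_zero, sub_zero, add_zero, smul_smul]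
    congr 2
    field_simp
  have h₂ : p₂.comp (((christoffel G y (i₁ v)).comp (christoffel G y (i₂ w))).comp i₂) =
      (fderiv ℝ a (p₁ y) v / a (p₁ y)) • christoffel G₂ (p₂ y) w
      + (1 / (a (p₁ y) * b (p₂ y))) • (G₂ (p₂ y) w).smulRight
        (fderiv ℝ a (p₁ y) v • gradient G₂ b (p₂ y)) := by
    ext x
    simp only [ContinuousLinearMap.comp_apply, h.swap.christoffel_inl_inl hy,
      h.christoffel_inl_inl hy, map_sub, map_smul,
      h.christoffel_inl_inr hy, map_add, h.snd_inl, h.snd_inr, add_apply,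
      smul_apply, ContinuousLinearMap.smulRight_apply, smul_zero, zero_sub, zero_add, smul_smul,
      sub_neg_eq_add, smul_neg, h.metric₁.apply_gradient_right hy₁]
    congr 2
    field_simp
  rw [h.traceCLM_eq, h₁, h₂]
  simp only [map_add, map_smul, traceCLM_smulRight, smul_eq_mul, h.metric₂.apply_gradient_right hy₂]
  field_simp
  ring

end IsDoublyWarpedOn

end Coord

/-! ### The Ricci tensor of a doubly warped product and its covariant derivative -/

namespace Coord

variable {E₁ E₂ F : Type*} [NormedAddCommGroup E₁] [NormedSpace ℝ E₁]
  [NormedAddCommGroup E₂] [NormedSpace ℝ E₂] [NormedAddCommGroup F] [NormedSpace ℝ F]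

namespace IsDoublyWarpedOn

variable [FiniteDimensional ℝ E₁] [FiniteDimensional ℝ E₂] [FiniteDimensional ℝ F]
  {p₁ : F →L[ℝ] E₁} {p₂ : F →L[ℝ] E₂} {i₁ : E₁ →L[ℝ] F}
  {i₂ : E₂ →L[ℝ] F} {G₁ : E₁ → E₁ →L[ℝ] E₁ →L[ℝ] ℝ} {G₂ : E₂ → E₂ →L[ℝ] E₂ →L[ℝ] ℝ}
  {a : E₁ → ℝ} {b : E₂ → ℝ} {U₁ : Set E₁} {U₂ : Set E₂}
  {G : F → F →L[ℝ] F →L[ℝ] ℝ} {U : Set F} {y : F}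

/-- The divergence of a field splits into the divergences along the slices. -/
theorem traceCLM_fderiv (h : IsDoublyWarpedOn p₁ p₂ i₁ i₂ G₁ G₂ a b U₁ U₂ G U) {X : F → F}
    (hX : DifferentiableAt ℝ X y) : traceCLM (fderiv ℝ X y) =
      traceCLM (fderiv ℝ (fun x ↦ p₁ (X (i₁ x + i₂ (p₂ y)))) (p₁ y)) +
      traceCLM (fderiv ℝ (fun x ↦ p₂ (X (i₂ x + i₁ (p₁ y)))) (p₂ y)) := by
  have h₁ := h.fderiv_comp_inl (f := fun z ↦ p₁ (X z)) (p₁.differentiableAt.comp y hX)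
  have h₂ := h.swap.fderiv_comp_inl (f := fun z ↦ p₂ (X z)) (p₂.differentiableAt.comp y hX)
  have k₁ : fderiv ℝ (fun z ↦ p₁ (X z)) y = p₁.comp (fderiv ℝ X y) :=
    (p₁.hasFDerivAt.comp y hX.hasFDerivAt).fderiv
  have k₂ : fderiv ℝ (fun z ↦ p₂ (X z)) y = p₂.comp (fderiv ℝ X y) :=
    (p₂.hasFDerivAt.comp y hX.hasFDerivAt).fderiv
  rw [← h₁, ← h₂, k₁, k₂, h.traceCLM_eq, ContinuousLinearMap.comp_assoc,
    ContinuousLinearMap.comp_assoc]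

theorem fst_slice (h : IsDoublyWarpedOn p₁ p₂ i₁ i₂ G₁ G₂ a b U₁ U₂ G U) (x : E₁) (w : E₂) :
    p₁ (i₁ x + i₂ w) = x := by simp [h.fst_inl, h.fst_inr]

theorem snd_slice (h : IsDoublyWarpedOn p₁ p₂ i₁ i₂ G₁ G₂ a b U₁ U₂ G U) (x : E₁) (w : E₂) :
    p₂ (i₁ x + i₂ w) = w := by simp [h.snd_inl, h.snd_inr]

theorem hasFDerivAt_inv₁ (h : IsDoublyWarpedOn p₁ p₂ i₁ i₂ G₁ G₂ a b U₁ U₂ G U) (hy : y ∈ U) :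
    HasFDerivAt (fun x ↦ (a x)⁻¹) (-(a (p₁ y) ^ 2)⁻¹ • fderiv ℝ a (p₁ y)) (p₁ y) :=
  (hasDerivAt_inv (h.ne_zero₁ _ (h.fst_mem y hy))).comp_hasFDerivAt (p₁ y)
    (h.differentiableAt₁ hy).hasFDerivAt

theorem differentiableAt_gradient₁ (h : IsDoublyWarpedOn p₁ p₂ i₁ i₂ G₁ G₂ a b U₁ U₂ G U)
    (hy : y ∈ U) : DifferentiableAt ℝ (gradient G₁ a) (p₁ y) :=
  (h.metric₁.differentiableAt_sharp (h.fst_mem y hy)).clm_apply (h.differentiableAt_fderiv₁ hy)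

theorem differentiableAt_christoffel_apply (h : IsDoublyWarpedOn p₁ p₂ i₁ i₂ G₁ G₂ a b U₁ U₂ G U)
    (hy : y ∈ U) (v w : F) : DifferentiableAt ℝ (fun z ↦ christoffel G z v w) y :=
  ((h.isMetricOn.differentiableAt_christoffel hy).clm_apply (differentiableAt_const v)).clm_apply
    (differentiableAt_const w)

theorem traceCLM_fderiv_christoffel_inl_inl (h : IsDoublyWarpedOn p₁ p₂ i₁ i₂ G₁ G₂ a b U₁ U₂ G U)
    (hy : y ∈ U) (v w : E₁) :
    traceCLM (fderiv ℝ (fun z ↦ christoffel G z (i₁ v) (i₁ w)) y) =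
      traceCLM (fderiv ℝ (fun x ↦ christoffel G₁ x v w) (p₁ y)) -
      G₁ (p₁ y) v w / a (p₁ y) ^ 2 * (b (p₂ y) * traceCLM (fderiv ℝ (gradient G₂ b) (p₂ y)) +
        fderiv ℝ b (p₂ y) (gradient G₂ b (p₂ y))) := by
  have e₁ : (fun x ↦ p₁ (christoffel G (i₁ x + i₂ (p₂ y)) (i₁ v) (i₁ w))) =ᶠ[nhds (p₁ y)]
      fun x ↦ christoffel G₁ x v w := by
    filter_upwards [h.slice_mem hy] with x hx
    rw [h.christoffel_inl_inl hx]
    simp [h.fst_inl, h.fst_inr]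
  -- Along the second slice the field is a constant multiple of `b grad b`, whose divergence is `b
  -- div(grad b) + db(grad b)`.
  have e₂ : (fun x ↦ p₂ (christoffel G (i₂ x + i₁ (p₁ y)) (i₁ v) (i₁ w))) =ᶠ[nhds (p₂ y)]
      fun x ↦ (-(G₁ (p₁ y) v w / a (p₁ y) ^ 2)) • (b x • gradient G₂ b x) := by
    filter_upwards [h.swap.slice_mem hy] with x hx
    rw [h.christoffel_inl_inl hx, add_comm, h.fst_slice, h.snd_slice]
    simp only [map_sub, map_smul, h.snd_inl, h.snd_inr, zero_sub, smul_smul, ← neg_smul]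
    congr 1
    ring
  have e₃ := (((h.swap.differentiableAt₁ hy).hasFDerivAt.fun_smul
    (h.swap.differentiableAt_gradient₁ hy).hasFDerivAt).fun_const_smul
      (-(G₁ (p₁ y) v w / a (p₁ y) ^ 2))).fderiv
  rw [h.traceCLM_fderiv (h.differentiableAt_christoffel_apply hy _ _), e₁.fderiv_eq,
    e₂.fderiv_eq, e₃]
  simp only [map_smul, map_add, traceCLM_smulRight, smul_eq_mul]
  ring

/-- Each component of this field depends only on the coordinates of the other factor, so both
partial divergences vanish. -/
theorem traceCLM_fderiv_christoffel_inl_inr (h : IsDoublyWarpedOn p₁ p₂ i₁ i₂ G₁ G₂ a b U₁ U₂ G U)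
    (hy : y ∈ U) (v : E₁) (w : E₂) :
    traceCLM (fderiv ℝ (fun z ↦ christoffel G z (i₁ v) (i₂ w)) y) = 0 := by
  have e₁ : (fun x ↦ p₁ (christoffel G (i₁ x + i₂ (p₂ y)) (i₁ v) (i₂ w))) =ᶠ[nhds (p₁ y)]
      fun x ↦ (fderiv ℝ b (p₂ y) w / b (p₂ y)) • v := by
    filter_upwards [h.slice_mem hy] with x hx
    rw [h.christoffel_inl_inr hx, h.fst_slice, h.snd_slice]
    simp [h.fst_inl, h.fst_inr]
  have e₂ : (fun x ↦ p₂ (christoffel G (i₂ x + i₁ (p₁ y)) (i₁ v) (i₂ w))) =ᶠ[nhds (p₂ y)]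
      fun x ↦ (fderiv ℝ a (p₁ y) v / a (p₁ y)) • w := by
    filter_upwards [h.swap.slice_mem hy] with x hx
    rw [h.christoffel_inl_inr hx, add_comm (i₂ x), h.fst_slice, h.snd_slice]
    simp [h.snd_inl, h.snd_inr]
  rw [h.traceCLM_fderiv (h.differentiableAt_christoffel_apply hy _ _), e₁.fderiv_eq,
    e₂.fderiv_eq]
  simp

theorem differentiableAt_traceCLM_christoffel (h : IsDoublyWarpedOn p₁ p₂ i₁ i₂ G₁ G₂ a b U₁ U₂ G U)
    (hy : y ∈ U) (w : F) : DifferentiableAt ℝ (fun z ↦ traceCLM (christoffel G z w)) y :=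
  (traceCLM (E := F)).differentiableAt.comp y
    ((h.isMetricOn.differentiableAt_christoffel hy).clm_apply (differentiableAt_const w))

/-- On the first factor the contracted symbol gains only `n₂ d(log a)`, which gives the second
derivative of `log a`. -/
theorem fderiv_traceCLM_christoffel_inl_inl (h : IsDoublyWarpedOn p₁ p₂ i₁ i₂ G₁ G₂ a b U₁ U₂ G U)
    (hy : y ∈ U) (v w : E₁) :
    fderiv ℝ (fun z ↦ traceCLM (christoffel G z (i₁ w))) y (i₁ v) =
      fderiv ℝ (fun x ↦ traceCLM (christoffel G₁ x w)) (p₁ y) v +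
      Module.finrank ℝ E₂ * (fderiv ℝ (fderiv ℝ a) (p₁ y) v w / a (p₁ y) -
        fderiv ℝ a (p₁ y) v * fderiv ℝ a (p₁ y) w / a (p₁ y) ^ 2) := by
  have ha := h.ne_zero₁ _ (h.fst_mem y hy)
  have e : (fun x ↦ traceCLM (christoffel G (i₁ x + i₂ (p₂ y)) (i₁ w))) =ᶠ[nhds (p₁ y)]
      fun x ↦ traceCLM (christoffel G₁ x w) +
        Module.finrank ℝ E₂ * (fderiv ℝ a x w / a x) := by
    filter_upwards [h.slice_mem hy] with x hx
    rw [h.traceCLM_christoffel hx, h.fst_slice, h.snd_slice, h.fst_inl, h.snd_inl]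
    simp
  have d₁ : DifferentiableAt ℝ (fun x ↦ traceCLM (christoffel G₁ x w)) (p₁ y) :=
    (traceCLM (E := E₁)).differentiableAt.comp _
      ((h.metric₁.differentiableAt_christoffel (h.fst_mem y hy)).clm_apply
        (differentiableAt_const w))
  have d₂ := ((h.differentiableAt_fderiv₁ hy).clm_apply
    (differentiableAt_const w)).hasFDerivAt.mul
      (h.hasFDerivAt_inv₁ hy)
  have d := (d₁.hasFDerivAt.fun_add (d₂.const_mul (Module.finrank ℝ E₂ : ℝ))).fderiv
  have := DFunLike.congr_fun
    (h.fderiv_comp_inl (h.differentiableAt_traceCLM_christoffel hy (i₁ w))) v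
  rw [ContinuousLinearMap.comp_apply] at this
  rw [this, e.fderiv_eq]
  refine (DFunLike.congr_fun d v).trans ?_
  simp only [add_apply, smul_apply, smul_eq_mul,
    fderiv_clm_apply_const (h.differentiableAt_fderiv₁ hy)]
  field_simp
  ring

/-- On `i₂ w` the contracted symbol depends on the second coordinate alone. -/
theorem fderiv_traceCLM_christoffel_inl_inr (h : IsDoublyWarpedOn p₁ p₂ i₁ i₂ G₁ G₂ a b U₁ U₂ G U)
    (hy : y ∈ U) (v : E₁) (w : E₂) :
    fderiv ℝ (fun z ↦ traceCLM (christoffel G z (i₂ w))) y (i₁ v) = 0 := by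
  have e : (fun x ↦ traceCLM (christoffel G (i₁ x + i₂ (p₂ y)) (i₂ w))) =ᶠ[nhds (p₁ y)]
      fun x ↦ traceCLM (christoffel G₂ (p₂ y) w) +
        Module.finrank ℝ E₁ * (fderiv ℝ b (p₂ y) w / b (p₂ y)) := by
    filter_upwards [h.slice_mem hy] with x hx
    rw [h.traceCLM_christoffel hx, h.fst_slice, h.snd_slice, h.fst_inr, h.snd_inr]
    simp
  have := DFunLike.congr_fun
    (h.fderiv_comp_inl (h.differentiableAt_traceCLM_christoffel hy (i₂ w))) v
  rw [ContinuousLinearMap.comp_apply] at this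
  rw [this, e.fderiv_eq]
  simp

/-- The Ricci tensor on vectors tangent to the first factor. -/
theorem ricci_inl_inl (h : IsDoublyWarpedOn p₁ p₂ i₁ i₂ G₁ G₂ a b U₁ U₂ G U)
    (hy : y ∈ U) (v w : E₁) : ricci G y (i₁ v) (i₁ w) =
      ricci G₁ (p₁ y) v w - Module.finrank ℝ E₂ / a (p₁ y) * hessian G₁ a (p₁ y) v w
      - (b (p₂ y) * laplacian G₂ b (p₂ y) +
        (Module.finrank ℝ E₁ - 1) * fderiv ℝ b (p₂ y) (gradient G₂ b (p₂ y))) / a (p₁ y) ^ 2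
        * G₁ (p₁ y) v w := by
  have hy₁ := h.fst_mem y hy
  have hy₂ := h.snd_mem y hy
  have ha := h.ne_zero₁ _ hy₁
  have hb := h.ne_zero₂ _ hy₂
  have hl := h.metric₂.laplacian_eq h.contDiffOn₂ hy₂
  change laplacian G₂ b (p₂ y) = traceCLM (fderiv ℝ (gradient G₂ b) (p₂ y)) +
    traceCLM (christoffel G₂ (p₂ y) (gradient G₂ b (p₂ y))) at hl
  rw [h.isMetricOn.ricci_eq hy, h.metric₁.ricci_eq hy₁,
    h.traceCLM_fderiv_christoffel_inl_inl hy, h.fderiv_traceCLM_christoffel_inl_inl hy,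
    h.traceCLM_christoffel_comp_inl_inl hy, h.traceCLM_christoffel hy,
    h.christoffel_inl_inl hy, hl, hessian]
  simp only [map_sub, map_smul, h.fst_inl, h.fst_inr, h.snd_inl, h.snd_inr, sub_apply, smul_zero,
    ContinuousLinearMap.comp_apply, ContinuousLinearMap.compL_apply, sub_zero, zero_sub, map_neg,
    smul_eq_mul]
  field_simp
  ring

/-- The mixed part of the Ricci tensor. -/
theorem ricci_inl_inr (h : IsDoublyWarpedOn p₁ p₂ i₁ i₂ G₁ G₂ a b U₁ U₂ G U)
    (hy : y ∈ U) (v : E₁) (w : E₂) : ricci G y (i₁ v) (i₂ w) =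
      (Module.finrank ℝ E₁ + Module.finrank ℝ E₂ - 2) *
        (fderiv ℝ a (p₁ y) v * fderiv ℝ b (p₂ y) w / (a (p₁ y) * b (p₂ y))) := by
  have ha := h.ne_zero₁ _ (h.fst_mem y hy)
  have hb := h.ne_zero₂ _ (h.snd_mem y hy)
  rw [h.isMetricOn.ricci_eq hy, h.traceCLM_fderiv_christoffel_inl_inr hy,
    h.fderiv_traceCLM_christoffel_inl_inr hy, h.traceCLM_christoffel_comp_inl_inr hy,
    h.traceCLM_christoffel hy, h.christoffel_inl_inr hy]
  -- The traces of `Γ₁` and `Γ₂` cancel. The coefficient `n₁ + n₂` comes from the warping terms of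
  -- `traceCLM_christoffel`, and `-2` from the trace of the composition.
  simp only [map_add, map_smul, h.fst_inl, h.fst_inr, h.snd_inl, h.snd_inr, smul_zero, zero_add,
    add_zero, smul_eq_mul]
  field_simp
  ring

theorem differentiableAt_hessian₁ (h : IsDoublyWarpedOn p₁ p₂ i₁ i₂ G₁ G₂ a b U₁ U₂ G U)
    (hy : y ∈ U) : DifferentiableAt ℝ (hessian G₁ a) (p₁ y) := by
  have hy₁ := h.fst_mem y hy
  have h₁ : DifferentiableAt ℝ (fderiv ℝ (fderiv ℝ a)) (p₁ y) :=
    ((h.contDiffOn_fderiv₁.fderiv_of_isOpen (m := ∞) h.metric₁.isOpen (by simp)).contDiffAt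
      (h.metric₁.mem_nhds hy₁)).differentiableAt (by simp)
  exact h₁.fun_sub (((ContinuousLinearMap.compL ℝ E₁ E₁ ℝ).differentiableAt.comp _
    (h.differentiableAt_fderiv₁ hy)).clm_comp (h.metric₁.differentiableAt_christoffel hy₁))

/-- The covariant derivative of the Ricci tensor on a vector tangent to the first factor. -/
theorem covDeriv_ricci_inl (h : IsDoublyWarpedOn p₁ p₂ i₁ i₂ G₁ G₂ a b U₁ U₂ G U)
    (hy : y ∈ U) (v : E₁) : covDeriv G (ricci G) y (i₁ v) (i₁ v) (i₁ v) =
      covDeriv G₁ (ricci G₁) (p₁ y) v v v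
      - covDeriv G₁ (fun x ↦ ((Module.finrank ℝ E₂ : ℝ) / a x) • hessian G₁ a x) (p₁ y) v v v
      + 2 / a (p₁ y) ^ 3 * fderiv ℝ a (p₁ y) v * G₁ (p₁ y) v v *
        (b (p₂ y) * laplacian G₂ b (p₂ y) +
          (Module.finrank ℝ E₁ - 1) * fderiv ℝ b (p₂ y) (gradient G₂ b (p₂ y)) +
          (Module.finrank ℝ E₁ + Module.finrank ℝ E₂ - 2) *
            fderiv ℝ b (p₂ y) (gradient G₂ b (p₂ y))) := by
  have hy₁ := h.fst_mem y hy
  have ha := h.ne_zero₁ _ hy₁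
  have hb := h.ne_zero₂ _ (h.snd_mem y hy)
  set T : E₁ → E₁ →L[ℝ] E₁ →L[ℝ] ℝ :=
    fun x ↦ ((Module.finrank ℝ E₂ : ℝ) / a x) • hessian G₁ a x with hT
  set δ : ℝ := b (p₂ y) * laplacian G₂ b (p₂ y) +
    (Module.finrank ℝ E₁ - 1) * fderiv ℝ b (p₂ y) (gradient G₂ b (p₂ y)) with hδ
  have dR : DifferentiableAt ℝ (ricci G₁) (p₁ y) := h.metric₁.differentiableAt_ricci hy₁
  have dG : DifferentiableAt ℝ G₁ (p₁ y) := h.metric₁.differentiableAt hy₁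
  have da := h.hasFDerivAt_inv₁ hy
  have dT : DifferentiableAt ℝ T (p₁ y) := by
    simp only [hT, div_eq_mul_inv]
    exact (da.differentiableAt.const_mul _).fun_smul (h.differentiableAt_hessian₁ hy)
  -- Along the slice `δ` is a constant, since it depends only on the second coordinate.
  have e : (fun x ↦ ricci G (i₁ x + i₂ (p₂ y)) (i₁ v) (i₁ v)) =ᶠ[nhds (p₁ y)]
      fun x ↦ ricci G₁ x v v - T x v v - δ * ((a x)⁻¹ ^ 2 * G₁ x v v) := by
    filter_upwards [h.slice_mem hy] with x hx
    rw [h.ricci_inl_inl hx, h.fst_slice, h.snd_slice]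
    simp only [hT, smul_apply, smul_eq_mul, hδ]
    ring
  have ev : ∀ {S : E₁ → E₁ →L[ℝ] E₁ →L[ℝ] ℝ}, DifferentiableAt ℝ S (p₁ y) →
      HasFDerivAt (fun x ↦ S x v v) (fderiv ℝ (fun x ↦ S x v v) (p₁ y)) (p₁ y) := fun hS ↦
    ((hS.clm_apply (differentiableAt_const v)).clm_apply (differentiableAt_const v)).hasFDerivAt
  have d := (((ev dR).fun_sub (ev dT)).fun_sub (((da.pow 2).mul (ev dG)).const_mul δ)).fderiv
  have dric : DifferentiableAt ℝ (fun z ↦ ricci G z (i₁ v) (i₁ v)) y :=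
    ((h.isMetricOn.differentiableAt_ricci hy).clm_apply (differentiableAt_const _)).clm_apply
      (differentiableAt_const _)
  have hf : fderiv ℝ (ricci G) y (i₁ v) (i₁ v) (i₁ v) =
      fderiv ℝ (ricci G₁) (p₁ y) v v v - fderiv ℝ T (p₁ y) v v v
      - δ * ((a (p₁ y))⁻¹ ^ 2 * fderiv ℝ G₁ (p₁ y) v v v
        - 2 * (a (p₁ y))⁻¹ ^ 3 * fderiv ℝ a (p₁ y) v * G₁ (p₁ y) v v) := by
    have := DFunLike.congr_fun (h.fderiv_comp_inl dric) v
    rw [ContinuousLinearMap.comp_apply] at this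
    rw [← fderiv_clm_apply_const₂ (h.isMetricOn.differentiableAt_ricci hy), this, e.fderiv_eq]
    refine (DFunLike.congr_fun d v).trans ?_
    simp only [sub_apply, smul_apply, add_apply, smul_eq_mul, nsmul_eq_mul,
      fderiv_clm_apply_const₂ dR, fderiv_clm_apply_const₂ dT, fderiv_clm_apply_const₂ dG,
      Nat.add_one_sub_one, pow_one, Nat.cast_ofNat]
    field_simp
    ring
  have hr : ∀ c d : E₁, ricci G y (i₁ c) (i₁ d) = ricci G₁ (p₁ y) c d - T (p₁ y) c d
      - δ / a (p₁ y) ^ 2 * G₁ (p₁ y) c d := fun c d ↦ by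
    rw [h.ricci_inl_inl hy, hδ]
    simp only [hT, smul_apply, smul_eq_mul]
  -- The component of `Γ(v, v)` in the second factor is a multiple of `grad b`; this value of `Ric`
  -- produces the summand with `n₁ + n₂ - 2`.
  have hβ := h.ricci_inl_inr hy v (gradient G₂ b (p₂ y))
  simp only [covDeriv, hf]
  rw [h.isMetricOn.ricci_symm hy (christoffel G y (i₁ v) (i₁ v)), h.christoffel_inl_inl hy,
    map_sub, map_smul, hβ, hr, h.metric₁.fderiv_apply hy₁]
  -- The symmetry of `T` is read off from that of the two Ricci tensors and of `G₁`.
  have hs : T (p₁ y) (christoffel G₁ (p₁ y) v v) v = T (p₁ y) v (christoffel G₁ (p₁ y) v v) := by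
    have h₁ := h.isMetricOn.ricci_symm hy (i₁ (christoffel G₁ (p₁ y) v v)) (i₁ v)
    rw [hr, hr, h.metric₁.ricci_symm hy₁ _ v, h.metric₁.symm _ hy₁ _ v] at h₁
    linarith
  rw [hs, h.metric₁.ricci_symm hy₁ (christoffel G₁ (p₁ y) v v),
    h.metric₁.symm _ hy₁ (christoffel G₁ (p₁ y) v v)]
  simp only [smul_eq_mul]
  field_simp
  ring

/-- If the tensor `L` of the product vanishes on a vector tangent to the first factor, then the one
of the first factor vanishes on it if and only if the derivative of `(n₂ / a) H^a` is as stated. -/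
theorem covDeriv_tensorL_eq_zero_iff (h : IsDoublyWarpedOn p₁ p₂ i₁ i₂ G₁ G₂ a b U₁ U₂ G U) (hy : y ∈ U)
    (hF : Module.finrank ℝ F = Module.finrank ℝ E₁ + Module.finrank ℝ E₂) (v : E₁)
    (hL : covDeriv G (tensorL G) y (i₁ v) (i₁ v) (i₁ v) = 0) :
    covDeriv G₁ (tensorL G₁) (p₁ y) v v v = 0 ↔
      covDeriv G₁ (fun x ↦ ((Module.finrank ℝ E₂ : ℝ) / a x) • hessian G₁ a x) (p₁ y) v v v =
        2 / a (p₁ y) ^ 3 * fderiv ℝ a (p₁ y) v * G₁ (p₁ y) v v *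
          (b (p₂ y) * laplacian G₂ b (p₂ y) +
            (Module.finrank ℝ E₁ - 1) * fderiv ℝ b (p₂ y) (gradient G₂ b (p₂ y)) +
            (Module.finrank ℝ E₁ + Module.finrank ℝ E₂ - 2) *
              fderiv ℝ b (p₂ y) (gradient G₂ b (p₂ y)))
        - 2 / ((Module.finrank ℝ E₁ : ℝ) + Module.finrank ℝ E₂ + 2) *
          (b (p₂ y) ^ 2 * fderiv ℝ (scal G) y (i₁ v) -
            ((Module.finrank ℝ E₁ : ℝ) + Module.finrank ℝ E₂ + 2) /
              (Module.finrank ℝ E₁ + 2) * fderiv ℝ (scal G₁) (p₁ y) v) * G₁ (p₁ y) v v := by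
  -- On the first factor `G` is `b² G₁`: this is the origin of the factor `b²` before the derivative
  -- of the scalar curvature of `G`.
  rw [h.isMetricOn.covDeriv_tensorL hy, h.covDeriv_ricci_inl hy, h.metric_apply y hy, h.fst_inl,
    h.snd_inl, hF] at hL
  rw [h.metric₁.covDeriv_tensorL (h.fst_mem y hy)]
  have h₁ : (Module.finrank ℝ E₁ : ℝ) + 2 ≠ 0 := by positivity
  have h₂ : (Module.finrank ℝ E₁ : ℝ) + Module.finrank ℝ E₂ + 2 ≠ 0 := by positivity
  -- The quotient `(n + 2) / (n₁ + 2)` only converts `2 / (n + 2)` into the coefficient `2 / (n₁ +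
  -- 2)` of the factor's own `L`.
  have h₃ : ∀ s t : ℝ, 2 / ((Module.finrank ℝ E₁ : ℝ) + Module.finrank ℝ E₂ + 2) *
      (s - ((Module.finrank ℝ E₁ : ℝ) + Module.finrank ℝ E₂ + 2) /
        (Module.finrank ℝ E₁ + 2) * t) =
      2 / ((Module.finrank ℝ E₁ : ℝ) + Module.finrank ℝ E₂ + 2) * s
        - 2 / (Module.finrank ℝ E₁ + 2) * t := fun s t ↦ by
    field_simp
  rw [h₃]
  simp only [map_zero, mul_zero, add_zero, Nat.cast_add] at hL
  constructor <;> intro hv <;> linarith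

end IsDoublyWarpedOn

end Coord

/-! ### From manifolds to charts -/

section Charts

variable {E : Type*} [NormedAddCommGroup E] [NormedSpace ℝ E]
  {H : Type*} [TopologicalSpace H] (I : ModelWithCorners ℝ E H) [I.Boundaryless]
  {M : Type*} [TopologicalSpace M] [ChartedSpace H M]

theorem dirDeriv_eq_fderiv {f : M → ℝ} {x : M} (hf : MDifferentiableAt I 𝓘(ℝ, ℝ) f x)
    (v : TangentSpace I x) :
    dirDeriv I f x v = fderiv ℝ (coordFun I f x) (extChartAt I x x) v := by
  simp only [dirDeriv, mfderiv, hf, I.range_eq_univ, fderivWithin_univ]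
  rfl

theorem mdifferentiableAt_extChartAt_symm [IsManifold I 1 M] (x : M) {y : E}
    (hy : y ∈ (extChartAt I x).target) :
    MDifferentiableAt 𝓘(ℝ, E) I (extChartAt I x).symm y := by
  have := mdifferentiableWithinAt_extChartAt_symm hy
  rwa [I.range_eq_univ, mdifferentiableWithinAt_univ] at this

/-- The derivative of the inverse chart, as a map of the coordinate space. -/
def chartSymmDeriv (x : M) (y : E) : E →L[ℝ] E :=
  mfderiv 𝓘(ℝ, E) I (extChartAt I x).symm y

/-- The tangent space at `x` is identified with `E` by the preferred chart at `x`, in which the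
inverse chart reads as the identity. -/
theorem chartSymmDeriv_self [IsManifold I 1 M] (x : M) (v : E) :
    chartSymmDeriv I x (extChartAt I x x) v = v := by
  have hm := mdifferentiableAt_extChartAt_symm I x (mem_extChartAt_target (I := I) x)
  have h : writtenInExtChartAt 𝓘(ℝ, E) I (extChartAt I x x) (extChartAt I x).symm
      =ᶠ[nhds (extChartAt I x x)] id := by
    filter_upwards [extChartAt_target_mem_nhds (I := I) x] with y hy
    change extChartAt I ((extChartAt I x).symm (extChartAt I x x)) ((extChartAt I x).symm y) = y
    rw [extChartAt_to_inv, (extChartAt I x).right_inv hy]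
  have h' : mfderiv 𝓘(ℝ, E) I (extChartAt I x).symm (extChartAt I x x) =
      fderiv ℝ (writtenInExtChartAt 𝓘(ℝ, E) I (extChartAt I x x) (extChartAt I x).symm)
        (extChartAt I x x) := by
    simp only [mfderiv, hm, ModelWithCorners.range_eq_univ, fderivWithin_univ]
    rfl
  have h'' := h'.trans h.fderiv_eq
  rw [fderiv_id] at h''
  exact DFunLike.congr_fun h'' v

/-- A bilinear form on a tangent space, evaluated on vectors of the coordinate space. -/
def tangentForm (g : ∀ x : M, TangentSpace I x →L[ℝ] TangentSpace I x →L[ℝ] ℝ) (x : M)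
    (v w : E) : ℝ :=
  g x v w

theorem coordMetric_apply (g : ∀ x : M, TangentSpace I x →L[ℝ] TangentSpace I x →L[ℝ] ℝ) (x : M)
    (y v w : E) : coordMetric I g x y v w = tangentForm I g ((extChartAt I x).symm y)
      (chartSymmDeriv I x y v) (chartSymmDeriv I x y w) := rfl

theorem coordMetric_self [IsManifold I 1 M]
    (g : ∀ x : M, TangentSpace I x →L[ℝ] TangentSpace I x →L[ℝ] ℝ) (x : M) :
    coordMetric I g x (extChartAt I x x) = g x := by
  have h : ∀ v w : E, coordMetric I g x (extChartAt I x x) v w = tangentForm I g x v w := by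
    intro v w
    rw [coordMetric_apply, chartSymmDeriv_self, chartSymmDeriv_self,
      extChartAt_to_inv]
  exact ContinuousLinearMap.ext fun v ↦ ContinuousLinearMap.ext fun w ↦ h v w

theorem contDiffOn_coordFun [IsManifold I ∞ M] {f : M → ℝ} (hf : ContMDiff I 𝓘(ℝ, ℝ) ∞ f)
    (x : M) : ContDiffOn ℝ ∞ (coordFun I f x) (extChartAt I x).target := by
  rw [← contMDiffOn_iff_contDiffOn]
  exact hf.comp_contMDiffOn (contMDiffOn_extChartAt_symm x)

theorem isInvertible_chartSymmDeriv [IsManifold I 1 M] (x : M) {y : E}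
    (hy : y ∈ (extChartAt I x).target) : (chartSymmDeriv I x y).IsInvertible := by
  have := isInvertible_mfderivWithin_extChartAt_symm hy
  rw [I.range_eq_univ, mfderivWithin_univ] at this
  exact this

/-- The tangent map of the inverse chart is smooth; it is composed with a constant vector field. -/
theorem contMDiffOn_mfderiv_extChartAt_symm [IsManifold I ∞ M] (x : M) (v : E) :
    ContMDiffOn 𝓘(ℝ, E) I.tangent ∞ (fun y ↦ (Bundle.TotalSpace.mk' E ((extChartAt I x).symm y)
      (mfderiv 𝓘(ℝ, E) I (extChartAt I x).symm y v) : TangentBundle I M))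
      (extChartAt I x).target := by
  have ho := isOpen_extChartAt_target (I := I) x
  have h := (contMDiffOn_extChartAt_symm (I := I) (n := ∞) x).contMDiffOn_tangentMapWithin
    (m := ∞) (by simp) ho.uniqueMDiffOn
  have hs : ContMDiffOn 𝓘(ℝ, E) 𝓘(ℝ, E).tangent ∞
      (fun y ↦ (Bundle.TotalSpace.mk' E y v : TangentBundle 𝓘(ℝ, E) E))
      (extChartAt I x).target :=
    contMDiffOn_vectorSpace_iff_contDiffOn.2 contDiffOn_const
  refine (h.comp hs fun y hy ↦ hy).congr fun y hy ↦ ?_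
  simp only [Function.comp_apply, tangentMapWithin, mfderivWithin_of_isOpen ho hy]

end Charts

section Charts

variable {E : Type*} [NormedAddCommGroup E] [NormedSpace ℝ E]
  {H : Type*} [TopologicalSpace H] (I : ModelWithCorners ℝ E H) [I.Boundaryless]
  {M : Type*} [TopologicalSpace M] [ChartedSpace H M]

theorem contMDiffOn_metric_mfderiv_extChartAt_symm [IsManifold I ∞ M]
    {g : ∀ x : M, TangentSpace I x →L[ℝ] TangentSpace I x →L[ℝ] ℝ}
    (hg : IsPseudoRiemannianMetric I g) (x : M) (v w : E) :
    ContMDiffOn 𝓘(ℝ, E) (I.prod 𝓘(ℝ, ℝ)) ∞ (fun y ↦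
        Bundle.TotalSpace.mk' ℝ (E := Bundle.Trivial M ℝ) ((extChartAt I x).symm y)
          (g ((extChartAt I x).symm y) (mfderiv 𝓘(ℝ, E) I (extChartAt I x).symm y v)
            (mfderiv 𝓘(ℝ, E) I (extChartAt I x).symm y w))) (extChartAt I x).target := by
  apply ContMDiffOn.clm_bundle_apply₂ (F₁ := E) (F₂ := E)
  · exact hg.contMDiff.comp_contMDiffOn (contMDiffOn_extChartAt_symm x)
  · exact contMDiffOn_mfderiv_extChartAt_symm I x v
  · exact contMDiffOn_mfderiv_extChartAt_symm I x w

theorem contDiffOn_coordMetric_apply [IsManifold I ∞ M]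
    {g : ∀ x : M, TangentSpace I x →L[ℝ] TangentSpace I x →L[ℝ] ℝ}
    (hg : IsPseudoRiemannianMetric I g) (x : M) (v w : E) :
    ContDiffOn ℝ ∞ (fun y ↦ coordMetric I g x y v w) (extChartAt I x).target := by
  rw [← contMDiffOn_iff_contDiffOn]
  intro y hy
  have h' := contMDiffOn_metric_mfderiv_extChartAt_symm I hg x v w y hy
  simp only [Bundle.contMDiffWithinAt_totalSpace] at h'
  exact h'.2

theorem coordMetric_nondegenerate [IsManifold I ∞ M]
    {g : ∀ x : M, TangentSpace I x →L[ℝ] TangentSpace I x →L[ℝ] ℝ}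
    (hg : IsPseudoRiemannianMetric I g) (x : M) {y : E} (hy : y ∈ (extChartAt I x).target) (v : E)
    (hv : ∀ w, coordMetric I g x y v w = 0) : v = 0 := by
  obtain ⟨e, he⟩ := isInvertible_chartSymmDeriv I x hy
  have h : ∀ w : E, tangentForm I g ((extChartAt I x).symm y) (e v) w = 0 := fun w ↦ by
    have := hv (e.symm w)
    rw [coordMetric_apply, ← he] at this
    simpa only [ContinuousLinearEquiv.coe_coe, e.apply_symm_apply] using this
  have h' : e v = 0 := hg.nondegenerate ((extChartAt I x).symm y) (e v) h
  exact e.map_eq_zero_iff.1 h'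

theorem coordMetric_symm [IsManifold I ∞ M]
    {g : ∀ x : M, TangentSpace I x →L[ℝ] TangentSpace I x →L[ℝ] ℝ}
    (hg : IsPseudoRiemannianMetric I g) (x : M) (y v w : E) :
    coordMetric I g x y v w = coordMetric I g x y w v := by
  rw [coordMetric_apply, coordMetric_apply]
  exact hg.symm _ _ _

theorem isMetricOn_coordMetric [FiniteDimensional ℝ E] [IsManifold I ∞ M]
    {g : ∀ x : M, TangentSpace I x →L[ℝ] TangentSpace I x →L[ℝ] ℝ}
    (hg : IsPseudoRiemannianMetric I g) (x : M) :
    Coord.IsMetricOn (coordMetric I g x) (extChartAt I x).target where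
  isOpen := isOpen_extChartAt_target x
  contDiffOn := Coord.contDiffOn_clm_apply₂.2 (contDiffOn_coordMetric_apply I hg x)
  symm y _ v w := coordMetric_symm I hg x y v w
  nondegenerate _ hy := coordMetric_nondegenerate I hg x hy

/-- The hypothesis concerns only the components in charts, so for the product it follows from
`IsDoublyWarpedOn.isMetricOn`; smoothness of the warped metric as a bundle section is not required.
-/
theorem isClassIA_iff [FiniteDimensional ℝ E] [IsManifold I ∞ M]
    {g : ∀ x : M, TangentSpace I x →L[ℝ] TangentSpace I x →L[ℝ] ℝ}
    (hg : ∀ x, ∃ U, extChartAt I x x ∈ U ∧ Coord.IsMetricOn (coordMetric I g x) U) :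
    IsClassIA I g ↔ ∀ (x : M) (X : E), Coord.covDeriv (coordMetric I g x)
      (Coord.tensorL (coordMetric I g x)) (extChartAt I x x) X X X = 0 := by
  refine forall_congr' fun x ↦ ?_
  obtain ⟨U, hxU, hU⟩ := hg x
  exact hU.cyclic_covDeriv_tensorL_eq_zero_iff hxU

theorem grad_eq_gradient [IsManifold I 1 M]
    (g : ∀ x : M, TangentSpace I x →L[ℝ] TangentSpace I x →L[ℝ] ℝ) {f : M → ℝ} {x : M}
    (hf : MDifferentiableAt I 𝓘(ℝ, ℝ) f x) :
    grad I g f x = Coord.gradient (coordMetric I g x) (coordFun I f x) (extChartAt I x x) := by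
  rw [Coord.gradient, coordMetric_self]
  have : (mfderiv I 𝓘(ℝ, ℝ) f x : E →L[ℝ] ℝ) = fderiv ℝ (coordFun I f x) (extChartAt I x x) :=
    ContinuousLinearMap.ext fun v ↦ dirDeriv_eq_fderiv I hf v
  rw [← this]
  rfl

theorem coordFun_self (f : M → ℝ) (x : M) : coordFun I f x (extChartAt I x x) = f x := by
  rw [coordFun, Function.comp_apply, extChartAt_to_inv]

theorem dirDeriv_grad [IsManifold I 1 M]
    (g : ∀ x : M, TangentSpace I x →L[ℝ] TangentSpace I x →L[ℝ] ℝ) {f : M → ℝ} {x : M}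
    (hf : MDifferentiableAt I 𝓘(ℝ, ℝ) f x) :
    dirDeriv I f x (grad I g f x) = fderiv ℝ (coordFun I f x) (extChartAt I x x)
      (Coord.gradient (coordMetric I g x) (coordFun I f x) (extChartAt I x x)) := by
  rw [dirDeriv_eq_fderiv I hf, grad_eq_gradient I g hf]

theorem diamond_eq [FiniteDimensional ℝ E] [IsManifold I ∞ M] (m : ℝ)
    {g : ∀ x : M, TangentSpace I x →L[ℝ] TangentSpace I x →L[ℝ] ℝ}
    (hg : IsPseudoRiemannianMetric I g) {f : M → ℝ} {x : M}
    (hf : MDifferentiableAt I 𝓘(ℝ, ℝ) f x) :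
    diamond I m g f x =
      coordFun I f x (extChartAt I x x) *
        Coord.laplacian (coordMetric I g x) (coordFun I f x) (extChartAt I x x) +
      (m - 1) * fderiv ℝ (coordFun I f x) (extChartAt I x x)
        (Coord.gradient (coordMetric I g x) (coordFun I f x) (extChartAt I x x)) := by
  have h := (isMetricOn_coordMetric I hg x).apply_gradient (mem_extChartAt_target x)
    (coordFun I f x) (Coord.gradient (coordMetric I g x) (coordFun I f x) (extChartAt I x x))
  rw [← h, coordFun_self, coordMetric_self, diamond, grad_eq_gradient I g hf]
  rfl

end Charts

/-! ### Product charts and the components of the doubly warped metric -/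

section Product

variable {E₁ E₂ : Type*} [NormedAddCommGroup E₁] [NormedSpace ℝ E₁] [FiniteDimensional ℝ E₁]
  [NormedAddCommGroup E₂] [NormedSpace ℝ E₂] [FiniteDimensional ℝ E₂]
  {H₁ H₂ : Type*} [TopologicalSpace H₁] [TopologicalSpace H₂]
  (I₁ : ModelWithCorners ℝ E₁ H₁) (I₂ : ModelWithCorners ℝ E₂ H₂)
  [I₁.Boundaryless] [I₂.Boundaryless]
  {M₁ M₂ : Type*} [TopologicalSpace M₁] [ChartedSpace H₁ M₁] [IsManifold I₁ ∞ M₁]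
  [TopologicalSpace M₂] [ChartedSpace H₂ M₂] [IsManifold I₂ ∞ M₂]

/-- The projections commute with the inverse charts; the two resulting expressions for the
derivative agree by uniqueness. -/
theorem fst_chartSymmDeriv_prod (x : M₁ × M₂) {z : E₁ × E₂}
    (hz : z ∈ (extChartAt (I₁.prod I₂) x).target) (v : E₁ × E₂) :
    (chartSymmDeriv (I₁.prod I₂) x z v).1 = chartSymmDeriv I₁ x.1 z.1 v.1 := by
  have hz₁ : z.1 ∈ (extChartAt I₁ x.1).target := by
    rw [extChartAt_prod] at hz
    exact hz.1
  have h₁ := (mdifferentiableAt_extChartAt_symm (I₁.prod I₂) x hz).hasMFDerivAt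
  have h₂ := (mdifferentiableAt_extChartAt_symm I₁ x.1 hz₁).hasMFDerivAt
  have h₃ := (hasMFDerivAt_fst (I := I₁) (I' := I₂) ((extChartAt (I₁.prod I₂) x).symm z)).comp z h₁
  have h₄ : HasMFDerivAt 𝓘(ℝ, E₁ × E₂) 𝓘(ℝ, E₁) (Prod.fst : E₁ × E₂ → E₁) z
    (ContinuousLinearMap.fst ℝ E₁ E₂) := (ContinuousLinearMap.fst ℝ E₁ E₂).hasMFDerivAt
  have h₅ := h₂.comp z h₄
  have h₆ : (Prod.fst ∘ (extChartAt (I₁.prod I₂) x).symm : E₁ × E₂ → M₁) =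
      (extChartAt I₁ x.1).symm ∘ Prod.fst := by
    rw [extChartAt_prod]
    rfl
  rw [h₆] at h₃
  exact DFunLike.congr_fun (hasMFDerivAt_unique h₃ h₅) v

theorem snd_chartSymmDeriv_prod (x : M₁ × M₂) {z : E₁ × E₂}
    (hz : z ∈ (extChartAt (I₁.prod I₂) x).target) (v : E₁ × E₂) :
    (chartSymmDeriv (I₁.prod I₂) x z v).2 = chartSymmDeriv I₂ x.2 z.2 v.2 := by
  have hz₂ : z.2 ∈ (extChartAt I₂ x.2).target := by
    rw [extChartAt_prod] at hz
    exact hz.2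
  have h₁ := (mdifferentiableAt_extChartAt_symm (I₁.prod I₂) x hz).hasMFDerivAt
  have h₂ := (mdifferentiableAt_extChartAt_symm I₂ x.2 hz₂).hasMFDerivAt
  have h₃ := (hasMFDerivAt_snd (I := I₁) (I' := I₂) ((extChartAt (I₁.prod I₂) x).symm z)).comp z h₁
  have h₄ : HasMFDerivAt 𝓘(ℝ, E₁ × E₂) 𝓘(ℝ, E₂) (Prod.snd : E₁ × E₂ → E₂) z
    (ContinuousLinearMap.snd ℝ E₁ E₂) := (ContinuousLinearMap.snd ℝ E₁ E₂).hasMFDerivAt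
  have h₅ := h₂.comp z h₄
  have h₆ : (Prod.snd ∘ (extChartAt (I₁.prod I₂) x).symm : E₁ × E₂ → M₂) =
      (extChartAt I₂ x.2).symm ∘ Prod.snd := by
    rw [extChartAt_prod]
    rfl
  rw [h₆] at h₃
  exact DFunLike.congr_fun (hasMFDerivAt_unique h₃ h₅) v

theorem tangentForm_doublyWarped
    (g₁ : ∀ p : M₁, TangentSpace I₁ p →L[ℝ] TangentSpace I₁ p →L[ℝ] ℝ)
    (g₂ : ∀ q : M₂, TangentSpace I₂ q →L[ℝ] TangentSpace I₂ q →L[ℝ] ℝ)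
    (f₁ : M₁ → ℝ) (f₂ : M₂ → ℝ) (x : M₁ × M₂) (v w : E₁ × E₂) :
    tangentForm (I₁.prod I₂) (doublyWarped I₁ I₂ g₁ g₂ f₁ f₂) x v w =
      f₂ x.2 ^ 2 * tangentForm I₁ g₁ x.1 v.1 w.1 + f₁ x.1 ^ 2 * tangentForm I₂ g₂ x.2 v.2 w.2 := by
  have h₁ : (mfderiv (I₁.prod I₂) I₁ (Prod.fst : M₁ × M₂ → M₁) x : E₁ × E₂ →L[ℝ] E₁) =
    ContinuousLinearMap.fst ℝ E₁ E₂ := mfderiv_fst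
  have h₂ : (mfderiv (I₁.prod I₂) I₂ (Prod.snd : M₁ × M₂ → M₂) x : E₁ × E₂ →L[ℝ] E₂) =
    ContinuousLinearMap.snd ℝ E₁ E₂ := mfderiv_snd
  have h₃ : tangentForm (I₁.prod I₂) (doublyWarped I₁ I₂ g₁ g₂ f₁ f₂) x v w =
      f₂ x.2 ^ 2 * tangentForm I₁ g₁ x.1
        ((mfderiv (I₁.prod I₂) I₁ (Prod.fst : M₁ × M₂ → M₁) x : E₁ × E₂ →L[ℝ] E₁) v)
        ((mfderiv (I₁.prod I₂) I₁ (Prod.fst : M₁ × M₂ → M₁) x : E₁ × E₂ →L[ℝ] E₁) w) +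
      f₁ x.1 ^ 2 * tangentForm I₂ g₂ x.2
        ((mfderiv (I₁.prod I₂) I₂ (Prod.snd : M₁ × M₂ → M₂) x : E₁ × E₂ →L[ℝ] E₂) v)
        ((mfderiv (I₁.prod I₂) I₂ (Prod.snd : M₁ × M₂ → M₂) x : E₁ × E₂ →L[ℝ] E₂) w) := rfl
  rw [h₃, h₁, h₂]
  rfl

theorem isDoublyWarpedOn_coordMetric
    {g₁ : ∀ p : M₁, TangentSpace I₁ p →L[ℝ] TangentSpace I₁ p →L[ℝ] ℝ}
    {g₂ : ∀ q : M₂, TangentSpace I₂ q →L[ℝ] TangentSpace I₂ q →L[ℝ] ℝ}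
    (hg₁ : IsPseudoRiemannianMetric I₁ g₁) (hg₂ : IsPseudoRiemannianMetric I₂ g₂)
    {f₁ : M₁ → ℝ} {f₂ : M₂ → ℝ} (hf₁ : ContMDiff I₁ 𝓘(ℝ, ℝ) ∞ f₁)
    (hf₂ : ContMDiff I₂ 𝓘(ℝ, ℝ) ∞ f₂) (hf₁_pos : ∀ p, 0 < f₁ p) (hf₂_pos : ∀ q, 0 < f₂ q)
    (x : M₁ × M₂) :
    Coord.IsDoublyWarpedOn (ContinuousLinearMap.fst ℝ E₁ E₂) (ContinuousLinearMap.snd ℝ E₁ E₂)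
      (ContinuousLinearMap.inl ℝ E₁ E₂) (ContinuousLinearMap.inr ℝ E₁ E₂)
      (coordMetric I₁ g₁ x.1) (coordMetric I₂ g₂ x.2) (coordFun I₁ f₁ x.1) (coordFun I₂ f₂ x.2)
      (extChartAt I₁ x.1).target (extChartAt I₂ x.2).target
      (coordMetric (I₁.prod I₂) (doublyWarped I₁ I₂ g₁ g₂ f₁ f₂) x)
      (extChartAt (I₁.prod I₂) x).target where
  fst_inl _ := rfl
  snd_inl _ := rfl
  fst_inr _ := rfl
  snd_inr _ := rfl
  add_eq z := by simp
  metric₁ := isMetricOn_coordMetric I₁ hg₁ x.1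
  metric₂ := isMetricOn_coordMetric I₂ hg₂ x.2
  contDiffOn₁ := contDiffOn_coordFun I₁ hf₁ x.1
  contDiffOn₂ := contDiffOn_coordFun I₂ hf₂ x.2
  ne_zero₁ _ _ := (hf₁_pos _).ne'
  ne_zero₂ _ _ := (hf₂_pos _).ne'
  isOpen := isOpen_extChartAt_target x
  fst_mem z hz := by
    rw [extChartAt_prod] at hz
    exact hz.1
  snd_mem z hz := by
    rw [extChartAt_prod] at hz
    exact hz.2
  metric_apply z hz v w := by
    have h₁ : ((extChartAt (I₁.prod I₂) x).symm z).1 = (extChartAt I₁ x.1).symm z.1 := by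
      rw [extChartAt_prod]
      rfl
    have h₂ : ((extChartAt (I₁.prod I₂) x).symm z).2 = (extChartAt I₂ x.2).symm z.2 := by
      rw [extChartAt_prod]
      rfl
    rw [coordMetric_apply, coordMetric_apply, coordMetric_apply, tangentForm_doublyWarped,
      fst_chartSymmDeriv_prod I₁ I₂ x hz, fst_chartSymmDeriv_prod I₁ I₂ x hz,
      snd_chartSymmDeriv_prod I₁ I₂ x hz, snd_chartSymmDeriv_prod I₁ I₂ x hz,
      h₁, h₂]
    rfl

end Product

end

/-! ### From the pointwise equivalence to the two factors -/

theorem mainTheorem5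
    {E₁ E₂ : Type*} [NormedAddCommGroup E₁] [NormedSpace ℝ E₁] [FiniteDimensional ℝ E₁]
    [NormedAddCommGroup E₂] [NormedSpace ℝ E₂] [FiniteDimensional ℝ E₂]
    {M₁ M₂ : Type*} [TopologicalSpace M₁] [ChartedSpace E₁ M₁] [IsManifold 𝓘(ℝ, E₁) ∞ M₁]
    [TopologicalSpace M₂] [ChartedSpace E₂ M₂] [IsManifold 𝓘(ℝ, E₂) ∞ M₂]
    [Nonempty M₁] [Nonempty M₂]
    (n₁ n₂ n : ℕ) (hn₁ : n₁ = Module.finrank ℝ E₁) (hn₂ : n₂ = Module.finrank ℝ E₂)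
    (hn : n = n₁ + n₂)
    (g₁ : ∀ p : M₁, TangentSpace 𝓘(ℝ, E₁) p →L[ℝ] TangentSpace 𝓘(ℝ, E₁) p →L[ℝ] ℝ)
    (g₂ : ∀ q : M₂, TangentSpace 𝓘(ℝ, E₂) q →L[ℝ] TangentSpace 𝓘(ℝ, E₂) q →L[ℝ] ℝ)
    (hg₁ : IsPseudoRiemannianMetric 𝓘(ℝ, E₁) g₁) (hg₂ : IsPseudoRiemannianMetric 𝓘(ℝ, E₂) g₂)
    (f₁ : M₁ → ℝ) (f₂ : M₂ → ℝ)
    (hf₁ : ContMDiff 𝓘(ℝ, E₁) 𝓘(ℝ, ℝ) ∞ f₁) (hf₂ : ContMDiff 𝓘(ℝ, E₂) 𝓘(ℝ, ℝ) ∞ f₂)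
    (hf₁_pos : ∀ p, 0 < f₁ p) (hf₂_pos : ∀ q, 0 < f₂ q)
    (g : ∀ x : M₁ × M₂, TangentSpace (𝓘(ℝ, E₁).prod 𝓘(ℝ, E₂)) x →L[ℝ]
      TangentSpace (𝓘(ℝ, E₁).prod 𝓘(ℝ, E₂)) x →L[ℝ] ℝ)
    (hg : g = doublyWarped 𝓘(ℝ, E₁) 𝓘(ℝ, E₂) g₁ g₂ f₁ f₂)
    (hM : IsClassIA (𝓘(ℝ, E₁).prod 𝓘(ℝ, E₂)) g) :
    (IsClassIA 𝓘(ℝ, E₁) g₁ ↔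
      ∀ (p : M₁) (q : M₂) (X : TangentSpace 𝓘(ℝ, E₁) p),
        covDerivF 𝓘(ℝ, E₁) n₂ g₁ f₁ p X X X =
          2 / (f₁ p) ^ 3 * dirDeriv 𝓘(ℝ, E₁) f₁ p X * g₁ p X X *
              (diamond 𝓘(ℝ, E₂) n₁ g₂ f₂ q
                + ((n : ℝ) - 2) * dirDeriv 𝓘(ℝ, E₂) f₂ q (grad 𝓘(ℝ, E₂) g₂ f₂ q))
            - 2 / ((n : ℝ) + 2) *
              ((f₂ q) ^ 2 * derivScal (𝓘(ℝ, E₁).prod 𝓘(ℝ, E₂)) g (p, q) (X, 0)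
                - ((n : ℝ) + 2) / ((n₁ : ℝ) + 2) * derivScal 𝓘(ℝ, E₁) g₁ p X) * g₁ p X X) ∧
    (IsClassIA 𝓘(ℝ, E₂) g₂ ↔
      ∀ (p : M₁) (q : M₂) (X : TangentSpace 𝓘(ℝ, E₂) q),
        covDerivF 𝓘(ℝ, E₂) n₁ g₂ f₂ q X X X =
          2 / (f₂ q) ^ 3 * dirDeriv 𝓘(ℝ, E₂) f₂ q X * g₂ q X X *
              (diamond 𝓘(ℝ, E₁) n₂ g₁ f₁ p
                + ((n : ℝ) - 2) * dirDeriv 𝓘(ℝ, E₁) f₁ p (grad 𝓘(ℝ, E₁) g₁ f₁ p))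
            - 2 / ((n : ℝ) + 2) *
              ((f₁ p) ^ 2 * derivScal (𝓘(ℝ, E₁).prod 𝓘(ℝ, E₂)) g (p, q) (0, X)
                - ((n : ℝ) + 2) / ((n₂ : ℝ) + 2) * derivScal 𝓘(ℝ, E₂) g₂ q X) * g₂ q X X) := by
  subst hn₁ hn₂ hn hg
  have hW := isDoublyWarpedOn_coordMetric 𝓘(ℝ, E₁) 𝓘(ℝ, E₂) hg₁ hg₂ hf₁ hf₂ hf₁_pos hf₂_pos
  have hmem : ∀ x : M₁ × M₂, extChartAt (𝓘(ℝ, E₁).prod 𝓘(ℝ, E₂)) x x ∈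
      (extChartAt (𝓘(ℝ, E₁).prod 𝓘(ℝ, E₂)) x).target := fun x ↦ mem_extChartAt_target x
  rw [isClassIA_iff _ fun x ↦ ⟨_, hmem x, (hW x).isMetricOn⟩] at hM
  have hfst : ∀ x : M₁ × M₂, ContinuousLinearMap.fst ℝ E₁ E₂
      (extChartAt (𝓘(ℝ, E₁).prod 𝓘(ℝ, E₂)) x x) = extChartAt 𝓘(ℝ, E₁) x.1 x.1 := fun x ↦ by
    rw [extChartAt_prod]
    rfl
  have hsnd : ∀ x : M₁ × M₂, ContinuousLinearMap.snd ℝ E₁ E₂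
      (extChartAt (𝓘(ℝ, E₁).prod 𝓘(ℝ, E₂)) x x) = extChartAt 𝓘(ℝ, E₂) x.2 x.2 := fun x ↦ by
    rw [extChartAt_prod]
    rfl
  have hd₁ : ∀ p, MDifferentiableAt 𝓘(ℝ, E₁) 𝓘(ℝ, ℝ) f₁ p := fun p ↦
    hf₁.mdifferentiableAt (by simp)
  have hd₂ : ∀ q, MDifferentiableAt 𝓘(ℝ, E₂) 𝓘(ℝ, ℝ) f₂ q := fun q ↦
    hf₂.mdifferentiableAt (by simp)
  constructor
  · rw [isClassIA_iff _ fun p ↦ ⟨_, mem_extChartAt_target p, isMetricOn_coordMetric _ hg₁ p⟩]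
    have key : ∀ (p : M₁) (q : M₂) (X : E₁), _ := fun p q X ↦
      (hW (p, q)).covDeriv_tensorL_eq_zero_iff (hmem (p, q)) Module.finrank_prod X
        (hM (p, q) (X, 0))
    simp only [hfst, hsnd, coordFun_self, coordMetric_self] at key
    simp only [diamond_eq _ _ hg₂ (hd₂ _), dirDeriv_grad _ _ (hd₂ _), coordFun_self,
      dirDeriv_eq_fderiv _ (hd₁ _), Nat.cast_add]
    -- The class of `M₁` does not involve `q`, so the equation at a single `q₀` already implies it.
    obtain ⟨q₀⟩ := ‹Nonempty M₂›
    exact ⟨fun H p q X ↦ (key p q X).1 (H p X), fun H p X ↦ (key p q₀ X).2 (H p q₀ X)⟩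
  · rw [isClassIA_iff _ fun q ↦ ⟨_, mem_extChartAt_target q, isMetricOn_coordMetric _ hg₂ q⟩]
    have key : ∀ (p : M₁) (q : M₂) (X : E₂), _ := fun p q X ↦
      (hW (p, q)).swap.covDeriv_tensorL_eq_zero_iff (hmem (p, q))
        (Module.finrank_prod.trans (add_comm _ _)) X (hM (p, q) (0, X))
    -- After `swap` the dimensions appear as `n₂ + n₁`.
    simp only [hfst, hsnd, coordFun_self, coordMetric_self,
      add_comm (Module.finrank ℝ E₂ : ℝ) (Module.finrank ℝ E₁)] at key
    simp only [diamond_eq _ _ hg₁ (hd₁ _), dirDeriv_grad _ _ (hd₁ _), coordFun_self,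
      dirDeriv_eq_fderiv _ (hd₂ _), Nat.cast_add]
    obtain ⟨p₀⟩ := ‹Nonempty M₁›
    exact ⟨fun H p q X ↦ (key p q X).1 (H q X), fun H q X ↦ (key p₀ q X).2 (H p₀ q X)⟩
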